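/- Let $n$ be an integer with $3\nmid n$ or $n\equiv 12\pmod{27}$, let $\rho\in\mathbb{C}$ be a root of Shanks' cubic polynomial $X^3-nX^2-(n+3)X-1$, and let $L_n=\mathbb{Q}(\rho)$ be the simplest cubic field, a cyclic cubic field in which the conjugates of $\rho$ are $\rho$, $\rho'=-1/(1+\rho)$ and $\rho''=-1/(1+\rho')$. A normal integral basis of $L_n$ is a $\mathbb{Z}$-basis of the ring of integers $\mathcal{O}_{L_n}$ of the form $\{\sigma(\alpha)\mid\sigma\in\mathrm{Gal}(L_n/\mathbb{Q})\}$. Write $n^2+3n+9=de^2c^3$ with positive integers $d,e,c$ such that $d$ and $e$ are square-free and coprime. Let $\zeta=e^{2\pi i/3}$, and let $a_0,a_1$ be integers with $ec=a_0^2-a_0a_1+a_1^2$ and $a_0+a_1\zeta\mid n+3(1+\zeta)$ in $\mathbb{Z}[\zeta]$. Then there is a (unique) sign $\varepsilon\in\{\pm1\}$ with $\varepsilon\equiv n(a_0+a_1)\pmod 3$ if $3\nmid n$, and $\varepsilon\equiv a_0\pmod 3$ if $n\equiv12\pmod{27}$; the number $m=(\varepsilon ec^2-n(a_0+a_1))/3$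 is an integer; and $L_n$ has exactly two normal integral bases, namely \[ \left\{\frac{a_0\rho+a_1\rho'+m}{ec^2},\ \frac{a_0\rho'+a_1\rho''+m}{ec^2},\ \frac{a_0\rho''+a_1\rho+m}{ec^2}\right\} \] and \[ \left\{-\frac{a_0\rho+a_1\rho'+m}{ec^2},\ -\frac{a_0\rho'+a_1\rho''+m}{ec^2},\ -\frac{a_0\rho''+a_1\rho+m}{ec^2}\right\}. \] -/

import Mathlib

open Polynomial IntermediateField

/-- Shanks' cubic polynomial `X³ - n X² - (n + 3) X - 1`. -/
noncomputable def shanksPoly (n : ℤ) : ℤ[X] :=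
  X ^ 3 - C n * X ^ 2 - C (n + 3) * X - 1

/-- The primitive cube root of unity `ζ = e^{2πi/3}`. -/
noncomputable def zetaThree : ℂ :=
  Complex.exp (2 * Real.pi * Complex.I / 3)

/-- The ring `ℤ[ζ]`, as a subring of `ℂ`. -/
noncomputable abbrev EisensteinRing : Subalgebra ℤ ℂ :=
  Algebra.adjoin ℤ {zetaThree}

/-- The element `x + y ζ` of `ℤ[ζ]`. -/
noncomputable def eisenstein (x y : ℤ) : EisensteinRing :=
  algebraMap ℤ EisensteinRing x
    + algebraMap ℤ EisensteinRing y
      * ⟨zetaThree, Algebra.self_mem_adjoin_singleton ℤ zetaThree⟩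

/-- `B` is a normal integral basis of the finite Galois extension `K / ℚ`: for some `α` in the ring
of integers, the conjugates `σ α`, `σ ∈ Gal(K/ℚ)`, form a `ℤ`-basis of the ring of integers,
and `B` is the set of these conjugates. -/
def IsNormalIntegralBasis (K : Type*) [Field K] [Algebra ℚ K] (B : Set K) : Prop :=
  ∃ (α : NumberField.RingOfIntegers K)
    (b : Module.Basis (K ≃ₐ[ℚ] K) ℤ (NumberField.RingOfIntegers K)),
    (∀ σ : K ≃ₐ[ℚ] K, (b σ : K) = σ (α : K)) ∧
      B = Set.range fun σ : K ≃ₐ[ℚ] K => σ (α : K)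

/-- The sign `ε ∈ {±1}` attached to `n`, `a₀`, `a₁`: it is congruent modulo 3 to `n (a₀ + a₁)` if
`3 ∤ n`, and to `a₀` if `n ≡ 12 (mod 27)`. -/
def IsShanksSign (n a₀ a₁ ε : ℤ) : Prop :=
  (ε = 1 ∨ ε = -1) ∧
    (¬ (3 : ℤ) ∣ n → ε ≡ n * (a₀ + a₁) [ZMOD 3]) ∧
    (n ≡ 12 [ZMOD 27] → ε ≡ a₀ [ZMOD 3])

/-- The map `x ↦ -1 / (1 + x)`, which permutes the roots of Shanks' cubic polynomial cyclically:
`ρ' = -1 / (1 + ρ)`, `ρ'' = -1 / (1 + ρ')`. -/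
def shanksConj {K : Type*} [Field K] (x : K) : K := -1 / (1 + x)

/-- The set `{(a₀ ρ + a₁ ρ' + m) / q, (a₀ ρ' + a₁ ρ'' + m) / q, (a₀ ρ'' + a₁ ρ + m) / q}`, where
`ρ' = -1 / (1 + ρ)` and `ρ'' = -1 / (1 + ρ')`. -/
def shanksTriple {K : Type*} [Field K] (ρ : K) (a₀ a₁ m q : ℤ) : Set K :=
  {((a₀ : K) * ρ + (a₁ : K) * shanksConj ρ + (m : K)) / (q : K),
   ((a₀ : K) * shanksConj ρ + (a₁ : K) * shanksConj (shanksConj ρ) + (m : K)) / (q : K),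
   ((a₀ : K) * shanksConj (shanksConj ρ) + (a₁ : K) * ρ + (m : K)) / (q : K)}

/-- The triple of the negatives of the members of `shanksTriple`. -/
def negShanksTriple {K : Type*} [Field K] (ρ : K) (a₀ a₁ m q : ℤ) : Set K :=
  {-(((a₀ : K) * ρ + (a₁ : K) * shanksConj ρ + (m : K)) / (q : K)),
   -(((a₀ : K) * shanksConj ρ + (a₁ : K) * shanksConj (shanksConj ρ) + (m : K)) / (q : K)),
   -(((a₀ : K) * shanksConj (shanksConj ρ) + (a₁ : K) * ρ + (m : K)) / (q : K))}

/-! The proof works with Lagrange resolvents. Put `A = a₀ + a₁ζ`, `w = n + 3 + 3ζ` and `D = de`. The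
resolvent of `ρ` has cube `(n² + 3n + 9) w`, and passing from `ρ` to the proposed generator `α`
multiplies it by `Ā / (ec²)`. So the resolvent `T` of `α` satisfies `T T̄ = D` and `T³ = D K`, where
`K = e w / A³` has norm `D`.

Everything rests on `K` lying in `ℤ[ζ]` and being congruent to `ε` mod 3 (`shanks_arithmetic`). The
trace of `α` is `ε`, and these congruences are what makes the other coefficients of the cubic of `α`
integral (`isIntegral_of_resolvents`).

The conjugates of `α` span the ring of integers: inverting their circulant matrix, of determinant
`±εD`, writes `Dβ` as an integral combination of them. Comparing resolvent cubes of `α` and `β`,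
with `D` squarefree and prime to 3, shows that `D` divides the coefficients
(`exists_int_combination`).

Two generators of normal integral bases differ by a unit of `ℤ[C₃]`, and those units are only `±`
the group elements (`units_cyclic_three`), which leaves the two triples. -/

/-! ### Eisenstein arithmetic: the quotient `K = e w / A³` -/

/-- The ring of Eisenstein integers `x + y ζ`, `ζ² = -1 - ζ`, in coordinates. -/
abbrev Eis : Type := QuadraticAlgebra ℤ (-1) (-1)

/-- Modulo `A` the product `t w` vanishes, so `t (w - w')² ≡ t w'²`. The left side is a unit mod
`A`, hence so is `w'`. It is applied with `w'` the conjugate of `w`. -/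
theorem coprime_of_dvd_mul {R : Type*} [CommRing R] {A N t w w' : R} (hAN : A ∣ N)
    (hA : A ∣ t * w) (hN : IsCoprime N (t * (w - w') ^ 2)) : IsCoprime A w' := by
  obtain ⟨u, v, huv⟩ := hN.of_isCoprime_of_dvd_left hAN
  obtain ⟨y, hy⟩ := hA
  exact ⟨u + v * y * (w - 2 * w'), v * t * w', by
    linear_combination huv - v * (w - 2 * w') * hy⟩

theorem intCast_isCoprime {R : Type*} [CommRing R] {a b : ℤ} (h : IsCoprime a b) :
    IsCoprime (a : R) (b : R) := h.map (Int.castRingHom R)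

/-- If `A` divides `t w` and the norm of `A` is `e c`, prime to `t (w - w̄)²`, then
`A³ ∣ e w` as soon as `w` has norm `d e² c³`. -/
theorem eis_cube_dvd {a₀ a₁ w₀ w₁ t d e c : ℤ}
    (hA : (⟨a₀, a₁⟩ : Eis) ∣ (t : Eis) * ⟨w₀, w₁⟩)
    (hnorm : e * c = a₀ ^ 2 - a₀ * a₁ + a₁ ^ 2)
    (hw : w₀ ^ 2 - w₀ * w₁ + w₁ ^ 2 = d * e ^ 2 * c ^ 3)
    (hco : IsCoprime (e * c) (t * (-3 * w₁ ^ 2))) :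
    (⟨a₀, a₁⟩ : Eis) ^ 3 ∣ (e : Eis) * ⟨w₀, w₁⟩ := by
  have hAA : (⟨a₀, a₁⟩ : Eis) * ⟨a₀ - a₁, -a₁⟩ = ((e * c : ℤ) : Eis) := by
    ext
    · rw [QuadraticAlgebra.re_intCast, hnorm]; simp; ring
    · rw [QuadraticAlgebra.im_intCast]; simp; ring
  have hww : (⟨w₀, w₁⟩ : Eis) * ⟨w₀ - w₁, -w₁⟩ = ((d * e ^ 2 * c ^ 3 : ℤ) : Eis) := by
    ext
    · rw [QuadraticAlgebra.re_intCast, ← hw]; simp; ring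
    · rw [QuadraticAlgebra.im_intCast]; simp; ring
  have hsq : ((⟨w₀, w₁⟩ : Eis) - ⟨w₀ - w₁, -w₁⟩) ^ 2 = ((-3 * w₁ ^ 2 : ℤ) : Eis) := by
    rw [pow_two]
    ext
    · rw [QuadraticAlgebra.re_intCast]; simp; ring
    · rw [QuadraticAlgebra.im_intCast]; simp; ring
  have hcop : IsCoprime (⟨a₀, a₁⟩ : Eis) ⟨w₀ - w₁, -w₁⟩ := by
    refine coprime_of_dvd_mul (N := ((e * c : ℤ) : Eis)) ⟨_, hAA.symm⟩ hA ?_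
    rw [hsq, ← Int.cast_mul]
    exact intCast_isCoprime hco
  -- Since `A Ā = ec` and `w w̄ = d e² c³`, one has `e w w̄ = d A³ Ā³`; coprimality then removes
  -- `w̄`.
  refine (hcop.pow_left (m := 3)).dvd_of_dvd_mul_right (z := ⟨w₀ - w₁, -w₁⟩) ?_
  refine ⟨(⟨a₀ - a₁, -a₁⟩ : Eis) ^ 3 * (d : Eis), ?_⟩
  rw [mul_assoc, hww, ← mul_assoc, ← mul_pow, hAA]
  push_cast
  ring

/-- From `n³ - 27 = (n - 3)(n² + 3n + 9)`, the class of `n / 3` mod `p` has order 3, so `3 ∣ p - 1`.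
-/
theorem prime_dvd_mod_three {n : ℤ} {p : ℕ} (hp : p.Prime) (h3 : p ≠ 3)
    (h : (p : ℤ) ∣ n ^ 2 + 3 * n + 9) : p % 3 = 1 := by
  have := Fact.mk hp
  have h0 : ((n : ZMod p)) ^ 2 + 3 * n + 9 = 0 := by
    have := (ZMod.intCast_zmod_eq_zero_iff_dvd _ p).2 h
    push_cast at this
    exact this
  have h30 : (3 : ZMod p) ≠ 0 := by
    intro h
    have : ((3 : ℕ) : ZMod p) = 0 := by exact_mod_cast h
    rw [ZMod.natCast_eq_zero_iff] at this
    exact h3 ((Nat.prime_dvd_prime_iff_eq hp Nat.prime_three).1 this)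
  have hx3 : ((n : ZMod p) / 3) ^ 3 = 1 := by
    field_simp
    linear_combination ((n : ZMod p) - 3) * h0
  have hx1 : ((n : ZMod p) / 3) ≠ 1 := by
    intro h
    have hn : (n : ZMod p) = 3 := by field_simp at h; exact h
    rw [hn] at h0
    have : (3 : ZMod p) ^ 3 = 0 := by linear_combination h0
    exact h30 (pow_eq_zero_iff (by norm_num) |>.1 this)
  have : Fact (Nat.Prime 3) := ⟨Nat.prime_three⟩
  have hord := orderOf_eq_prime hx3 hx1
  have hne : ((n : ZMod p) / 3) ≠ 0 := by
    intro h; rw [h] at hx3; norm_num at hx3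
  have hdvd := ZMod.orderOf_dvd_card_sub_one hne
  rw [hord] at hdvd
  have := hp.two_le
  omega

theorem nat_mod_three_of_primes (m : ℕ) (hm : m ≠ 0)
    (h : ∀ p : ℕ, p.Prime → p ∣ m → p % 3 = 1) : m % 3 = 1 := by
  induction m using Nat.recOnMul with
  | zero => exact absurd rfl hm
  | one => rfl
  | prime p hp => exact h p hp dvd_rfl
  | mul a b ha hb =>
    rw [Nat.mul_mod, ha (left_ne_zero_of_mul hm) fun p hp hd => h p hp (hd.mul_right b),
      hb (right_ne_zero_of_mul hm) fun p hp hd => h p hp (hd.mul_left a)]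

theorem pos_dvd_modEq_one {n e : ℤ} (he : 0 < e) (h3 : ¬ (3 : ℤ) ∣ e)
    (h : e ∣ n ^ 2 + 3 * n + 9) : e ≡ 1 [ZMOD 3] := by
  lift e to ℕ using he.le
  have : e % 3 = 1 := by
    refine nat_mod_three_of_primes e (by omega) fun p hp hd => prime_dvd_mod_three hp ?_
      (dvd_trans (by exact_mod_cast hd) h)
    rintro rfl
    exact h3 (by exact_mod_cast hd)
  unfold Int.ModEq
  omega

/-! ### Transfer from `ℤ[ζ] ⊂ ℂ` to coordinates -/

theorem zetaThree_sq : zetaThree ^ 2 = -1 - zetaThree := by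
  have h := (Complex.isPrimitiveRoot_exp 3 (by norm_num)).geom_sum_eq_zero (by norm_num)
  simp only [Finset.sum_range_succ, Finset.sum_range_zero] at h
  have hz : zetaThree = Complex.exp (2 * Real.pi * Complex.I / (3 : ℕ)) := by
    simp [zetaThree]
  rw [hz]
  linear_combination h

theorem eisenstein_coe (x y : ℤ) : ((eisenstein x y : EisensteinRing) : ℂ) = x + y * zetaThree := by
  simp [eisenstein]

theorem exists_eisenstein_eq (z : EisensteinRing) : ∃ x y : ℤ, z = eisenstein x y := by
  suffices ∀ w ∈ EisensteinRing, ∃ x y : ℤ, w = x + y * zetaThree by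
    obtain ⟨x, y, h⟩ := this z z.2
    exact ⟨x, y, Subtype.ext (by rw [h, eisenstein_coe])⟩
  intro w hw
  induction hw using Algebra.adjoin_induction with
  | mem w hw => exact ⟨0, 1, by rw [Set.mem_singleton_iff.1 hw]; simp⟩
  | algebraMap r => exact ⟨r, 0, by simp⟩
  | add a b _ _ ha hb =>
    obtain ⟨x, y, rfl⟩ := ha
    obtain ⟨u, v, rfl⟩ := hb
    exact ⟨x + u, y + v, by push_cast; ring⟩
  | mul a b _ _ ha hb =>
    obtain ⟨x, y, rfl⟩ := ha
    obtain ⟨u, v, rfl⟩ := hb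
    exact ⟨x * u - y * v, x * v + y * u - y * v, by
      push_cast; linear_combination (y * v : ℂ) * zetaThree_sq⟩

theorem zetaThree_im_ne_zero : zetaThree.im ≠ 0 := by
  intro h
  have h2 := congrArg Complex.re zetaThree_sq
  rw [pow_two, Complex.mul_re, h] at h2
  simp at h2
  nlinarith [sq_nonneg (zetaThree.re + 1 / 2)]

theorem add_mul_zetaThree_inj {x y u v : ℤ}
    (h : (x : ℂ) + y * zetaThree = u + v * zetaThree) : x = u ∧ y = v := by
  have him := congrArg Complex.im h
  simp [zetaThree_im_ne_zero] at him
  subst him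
  exact ⟨by simpa using h, rfl⟩

theorem eis_dvd_of_eisenstein_dvd {x y u v : ℤ} (h : eisenstein x y ∣ eisenstein u v) :
    (⟨x, y⟩ : Eis) ∣ ⟨u, v⟩ := by
  obtain ⟨z, hz⟩ := h
  obtain ⟨r, s, rfl⟩ := exists_eisenstein_eq z
  have hz' := congrArg (Subtype.val : EisensteinRing → ℂ) hz
  rw [Subalgebra.coe_mul, eisenstein_coe, eisenstein_coe, eisenstein_coe] at hz'
  have := add_mul_zetaThree_inj (x := u) (y := v) (u := x * r - y * s)
    (v := x * s + y * r - y * s) (by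
      push_cast; linear_combination hz' + (y * s : ℂ) * zetaThree_sq)
  refine ⟨⟨r, s⟩, ?_⟩
  ext
  · simp; linarith [this.1]
  · simp; linarith [this.2]

/-! ### The quotient `K` modulo 3 and the choice of sign -/

theorem zmod_three_eq_of_cube_mul_eq (a w k₀ k₁ ε : ZMod 3) (h₀ : a ^ 3 * k₀ = w) (h₁ : a ^ 3 * k₁ = 0)
    (hw : w ≠ 0) (hε : ε = w * a) : k₁ = 0 ∧ k₀ = ε := by
  subst h₀ hε
  revert a k₀ k₁
  decide

theorem eis_cube (x y : ℤ) : (⟨x, y⟩ : Eis) ^ 3 =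
    ⟨x ^ 3 + y ^ 3 - 3 * x * y ^ 2, 3 * x ^ 2 * y - 3 * x * y ^ 2⟩ := by
  rw [pow_succ, pow_two]
  ext <;> simp <;> ring

/-- The quotient `K = e w / A³` has norm `d e` and is congruent to a rational integer mod `3`. -/
theorem exists_cube_mul_eq {a₀ a₁ w₀ w₁ t d e c : ℤ}
    (hA : (⟨a₀, a₁⟩ : Eis) ∣ (t : Eis) * ⟨w₀, w₁⟩)
    (hnorm : e * c = a₀ ^ 2 - a₀ * a₁ + a₁ ^ 2)
    (hw : w₀ ^ 2 - w₀ * w₁ + w₁ ^ 2 = d * e ^ 2 * c ^ 3)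
    (hco : IsCoprime (e * c) (t * (-3 * w₁ ^ 2)))
    (he : e ≡ 1 [ZMOD 3]) (he0 : e ≠ 0) (hc0 : c ≠ 0) (hw₁ : 3 ∣ w₁) (hw₀ : ¬ 3 ∣ w₀) :
    ∃ k₀ k₁ : ℤ, (⟨a₀, a₁⟩ : Eis) ^ 3 * ⟨k₀, k₁⟩ = (e : Eis) * ⟨w₀, w₁⟩ ∧
      k₀ ^ 2 - k₀ * k₁ + k₁ ^ 2 = d * e ∧
      ∀ ε : ℤ, ε ≡ w₀ * (a₀ + a₁) [ZMOD 3] → 3 ∣ k₁ ∧ 3 ∣ k₀ - ε := by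
  obtain ⟨⟨k₀, k₁⟩, hk⟩ := eis_cube_dvd hA hnorm hw hco
  refine ⟨k₀, k₁, hk.symm, ?_, ?_⟩
  · have h := congrArg QuadraticAlgebra.norm hk
    rw [map_mul, map_mul, map_pow] at h
    simp only [QuadraticAlgebra.norm_def, QuadraticAlgebra.re_intCast,
      QuadraticAlgebra.im_intCast] at h
    have h1 : (e * c) ^ 3 * (k₀ ^ 2 - k₀ * k₁ + k₁ ^ 2) = (e * c) ^ 3 * (d * e) := by
      rw [show (e * c) ^ 3 * (d * e) = e ^ 2 * (d * e ^ 2 * c ^ 3) by ring, ← hw, hnorm]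
      linear_combination -h
    exact mul_left_cancel₀ (pow_ne_zero 3 (mul_ne_zero he0 hc0)) h1
  · intro ε hε
    rw [eis_cube] at hk
    have h0 := congrArg QuadraticAlgebra.re hk
    have h1 := congrArg QuadraticAlgebra.im hk
    simp only [QuadraticAlgebra.re_mul, QuadraticAlgebra.im_mul, QuadraticAlgebra.re_intCast,
      QuadraticAlgebra.im_intCast] at h0 h1
    have e1 : (e : ZMod 3) = 1 := by simpa using (ZMod.intCast_eq_intCast_iff e 1 3).2 he
    have e2 := (ZMod.intCast_eq_intCast_iff _ _ 3).2 hε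
    have e3 : (w₁ : ZMod 3) = 0 := (ZMod.intCast_zmod_eq_zero_iff_dvd w₁ 3).2 hw₁
    have e4 : (w₀ : ZMod 3) ≠ 0 := fun h => hw₀ ((ZMod.intCast_zmod_eq_zero_iff_dvd w₀ 3).1 h)
    have e5 : (3 : ZMod 3) = 0 := rfl
    have f0 := congrArg (Int.cast : ℤ → ZMod 3) h0
    have f1 := congrArg (Int.cast : ℤ → ZMod 3) h1
    push_cast at f0 f1 e2
    rw [e1, e3] at f0 f1
    simp only [e5] at f0 f1
    -- Cubing is additive mod 3 and `ζ³ = 1`, so `A³ ≡ (a₀ + a₁)³` is rational. With `e ≡ 1` and `w₁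
    -- ≡ 0` this forces `k₁ ≡ 0` and `k₀ ≡ w₀ (a₀ + a₁) ≡ ε`.
    have := zmod_three_eq_of_cube_mul_eq (a₀ + a₁) w₀ k₀ k₁ ε
      (by linear_combination -f0 + ((a₀ ^ 2 * a₁ + a₀ * a₁ ^ 2) * k₀) * e5)
      (by linear_combination -f1 + ((a₀ ^ 2 * a₁ + a₀ * a₁ ^ 2) * k₁) * e5) e4 e2
    refine ⟨(ZMod.intCast_zmod_eq_zero_iff_dvd k₁ 3).1 this.1,
      (ZMod.intCast_zmod_eq_zero_iff_dvd _ 3).1 ?_⟩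
    push_cast
    rw [this.2, sub_self]

theorem isCoprime_three_of_not_dvd {x : ℤ} (h : ¬ (3 : ℤ) ∣ x) : IsCoprime x 3 :=
  ((Int.prime_three.irreducible.coprime_iff_not_dvd).2 h).symm

theorem zmod_three_ne_zero {x : ℤ} (h : ¬ (3 : ℤ) ∣ x) : (x : ZMod 3) ≠ 0 :=
  fun h' => h ((ZMod.intCast_zmod_eq_zero_iff_dvd x 3).1 h')

theorem zmod_three_sq : ∀ x : ZMod 3, x ≠ 0 → x ^ 2 = 1 := by decide

theorem exists_cube_mul_eq_of_not_dvd {n d e c a₀ a₁ : ℤ} (hn : ¬ (3 : ℤ) ∣ n)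
    (he : 0 < e) (hc : 0 < c)
    (hΔ : n ^ 2 + 3 * n + 9 = d * e ^ 2 * c ^ 3)
    (hnorm : e * c = a₀ ^ 2 - a₀ * a₁ + a₁ ^ 2)
    (hdvd : (⟨a₀, a₁⟩ : Eis) ∣ ⟨n + 3, 3⟩) :
    ¬ (3 : ℤ) ∣ d * e ∧ ∃ k₀ k₁ : ℤ,
      (⟨a₀, a₁⟩ : Eis) ^ 3 * ⟨k₀, k₁⟩ = (e : Eis) * ⟨n + 3, 3⟩ ∧
      k₀ ^ 2 - k₀ * k₁ + k₁ ^ 2 = d * e ∧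
      ∀ ε : ℤ, ε ≡ n * (a₀ + a₁) [ZMOD 3] →
        3 ∣ k₁ ∧ 3 ∣ k₀ - ε ∧ 3 ∣ ε * e * c ^ 2 - n * (a₀ + a₁) := by
  have hΔ3 : ¬ (3 : ℤ) ∣ d * e ^ 2 * c ^ 3 := by
    rw [← hΔ]
    intro h
    have h2 : (3 : ℤ) ∣ n ^ 2 := by
      have h3 : (3 : ℤ) ∣ 3 * n + 9 := ⟨n + 3, by ring⟩
      rw [add_assoc] at h
      exact (dvd_add_left h3).1 h
    exact hn (Int.prime_three.dvd_of_dvd_pow h2)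
  have hde : ¬ (3 : ℤ) ∣ d * e := fun h => hΔ3 (h.trans ⟨e * c ^ 3, by ring⟩)
  have hec : ¬ (3 : ℤ) ∣ e * c := fun h => hΔ3 (h.trans ⟨d * e * c ^ 2, by ring⟩)
  have he3 : ¬ (3 : ℤ) ∣ e := fun h => hec (h.mul_right c)
  have hc3 : ¬ (3 : ℤ) ∣ c := fun h => hec (h.mul_left e)
  have he1 := pos_dvd_modEq_one (n := n) he he3 ⟨d * e * c ^ 3, by rw [hΔ]; ring⟩
  obtain ⟨k₀, k₁, h1, h2, h3⟩ := exists_cube_mul_eq (t := 1) (w₀ := n + 3) (w₁ := 3) (d := d)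
    (by simpa using hdvd) hnorm (by rw [← hΔ]; ring)
    (by
      have h := (isCoprime_three_of_not_dvd hec).pow_right (n := 3)
      rw [show (1 : ℤ) * (-3 * 3 ^ 2) = -(3 ^ 3) by norm_num]
      exact h.neg_right) he1 he.ne' hc.ne' dvd_rfl
    (fun h => hn (by simpa using h))
  refine ⟨hde, k₀, k₁, h1, h2, fun ε hε => ?_⟩
  have hε' : ε ≡ (n + 3) * (a₀ + a₁) [ZMOD 3] := hε.trans (Int.modEq_iff_dvd.2 ⟨a₀ + a₁, by ring⟩)
  refine ⟨(h3 ε hε').1, (h3 ε hε').2, (ZMod.intCast_zmod_eq_zero_iff_dvd _ 3).1 ?_⟩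
  have e1 : (e : ZMod 3) = 1 := by simpa using (ZMod.intCast_eq_intCast_iff e 1 3).2 he1
  have e2 := (ZMod.intCast_eq_intCast_iff _ _ 3).2 hε
  push_cast at e2 ⊢
  rw [e1, e2, zmod_three_sq c (zmod_three_ne_zero hc3)]
  ring

/-- As `d`, `e` are squarefree and coprime, `d e²` has 3-adic valuation at most 2, so 27 cannot
divide it. -/
theorem three_dvd_of_eq {d e c x : ℤ} (hdsq : Squarefree d) (hesq : Squarefree e)
    (hde : IsCoprime d e) (h : d * e ^ 2 * c ^ 3 = 27 * x) : (3 : ℤ) ∣ c := by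
  by_contra hc
  have h3 : (3 : ℤ) ^ 3 ∣ d * e ^ 2 := by
    refine ((isCoprime_three_of_not_dvd hc).symm.pow (m := 3) (n := 3)).dvd_of_dvd_mul_right ?_
    exact ⟨x, by rw [h]; norm_num⟩
  have hsq : ∀ y : ℤ, Squarefree y → ¬ (3 : ℤ) ^ 2 ∣ y := fun y hy h => by
    have := hy 3 (by rwa [← pow_two])
    rw [Int.isUnit_iff] at this
    omega
  by_cases hd : (3 : ℤ) ∣ d
  · have he : ¬ (3 : ℤ) ∣ e := fun he => by
      have := hde.isUnit_of_dvd' hd he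
      rw [Int.isUnit_iff] at this
      omega
    have := ((isCoprime_three_of_not_dvd he).symm.pow (m := 3) (n := 2)).dvd_of_dvd_mul_right h3
    exact hsq d hdsq ((pow_dvd_pow 3 (by norm_num)).trans this)
  · have := ((isCoprime_three_of_not_dvd hd).symm.pow_left (m := 3)).dvd_of_dvd_mul_left h3
    have h9 : (3 : ℤ) ∣ e := Int.prime_three.dvd_of_dvd_pow ((dvd_pow_self 3 (by norm_num)).trans this)
    obtain ⟨y, rfl⟩ := h9
    have : (3 : ℤ) ∣ y ^ 2 := by
      obtain ⟨z, hz⟩ := this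
      exact ⟨z, by linarith⟩
    obtain ⟨z, rfl⟩ := Int.prime_three.dvd_of_dvd_pow this
    exact hsq _ hesq ⟨z, by ring⟩

/-- Here `A` and `w` are not prime to 3, so powers of `1 - ζ` are split off. With `n = 12 + 27k`, `w
= (1 - ζ)³ w'` for `w' = 1 + 3k + (3 + 6k)ζ`, and `A = (1 - ζ)(p + qζ)`. The cubes of `1 - ζ` cancel
in `K`, and `c` is replaced by `c / 3`. -/
theorem exists_cube_mul_eq_of_modEq {n d e c a₀ a₁ : ℤ} (hn : n ≡ 12 [ZMOD 27])
    (he : 0 < e) (hc : 0 < c)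
    (hdsq : Squarefree d) (hesq : Squarefree e) (hde : IsCoprime d e)
    (hΔ : n ^ 2 + 3 * n + 9 = d * e ^ 2 * c ^ 3)
    (hnorm : e * c = a₀ ^ 2 - a₀ * a₁ + a₁ ^ 2)
    (hdvd : (⟨a₀, a₁⟩ : Eis) ∣ ⟨n + 3, 3⟩) :
    ¬ (3 : ℤ) ∣ a₀ ∧ ¬ (3 : ℤ) ∣ d * e ∧ ∃ k₀ k₁ : ℤ,
      (⟨a₀, a₁⟩ : Eis) ^ 3 * ⟨k₀, k₁⟩ = (e : Eis) * ⟨n + 3, 3⟩ ∧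
      k₀ ^ 2 - k₀ * k₁ + k₁ ^ 2 = d * e ∧
      ∀ ε : ℤ, ε ≡ a₀ [ZMOD 3] →
        3 ∣ k₁ ∧ 3 ∣ k₀ - ε ∧ 3 ∣ ε * e * c ^ 2 - n * (a₀ + a₁) := by
  obtain ⟨k, hk⟩ := Int.modEq_iff_dvd.1 hn.symm
  obtain rfl : n = 12 + 27 * k := by linarith
  obtain ⟨c, rfl⟩ := three_dvd_of_eq (x := 7 + 27 * k + 27 * k ^ 2) hdsq hesq hde
    (by rw [← hΔ]; ring)
  have hc' : 0 < c := by linarith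
  have hw : (1 + 3 * k) ^ 2 - (1 + 3 * k) * (3 + 6 * k) + (3 + 6 * k) ^ 2 = d * e ^ 2 * c ^ 3 := by
    linarith
  have hΔ3 : ¬ (3 : ℤ) ∣ d * e ^ 2 * c ^ 3 := by
    rw [← hw]
    rintro ⟨y, hy⟩
    have : 3 * (y - (2 + 9 * k + 9 * k ^ 2)) = 1 := by linarith
    omega
  have hde : ¬ (3 : ℤ) ∣ d * e := fun h => hΔ3 (h.trans ⟨e * c ^ 3, by ring⟩)
  have hec : ¬ (3 : ℤ) ∣ e * c := fun h => hΔ3 (h.trans ⟨d * e * c ^ 2, by ring⟩)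
  have he3 : ¬ (3 : ℤ) ∣ e := fun h => hec (h.mul_right c)
  have he1 := pos_dvd_modEq_one (n := 12 + 27 * k) he he3
    ⟨d * e * (3 * c) ^ 3, by rw [hΔ]; ring⟩
  -- The norm of `A` is `(a₀ + a₁)² - 3a₀a₁`, and `c` is a multiple of 3.
  obtain ⟨q, hq⟩ : (3 : ℤ) ∣ a₀ + a₁ := by
    refine Int.prime_three.dvd_of_dvd_pow (n := 2) ⟨e * c + a₀ * a₁, ?_⟩
    linear_combination hnorm.symm
  obtain ⟨p, rfl⟩ : ∃ p, a₀ = p + q := ⟨a₀ - q, by ring⟩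
  obtain rfl : a₁ = 2 * q - p := by linarith
  have hnorm' : e * c = p ^ 2 - p * q + q ^ 2 := by linarith
  have hdvd' : (⟨p, q⟩ : Eis) ∣ ((3 : ℤ) : Eis) * ⟨1 + 3 * k, 3 + 6 * k⟩ := by
    obtain ⟨⟨b₀, b₁⟩, hb⟩ := hdvd
    have h0 := congrArg QuadraticAlgebra.re hb
    have h1 := congrArg QuadraticAlgebra.im hb
    simp only [QuadraticAlgebra.re_mul, QuadraticAlgebra.im_mul] at h0 h1
    -- Cancelling one `1 - ζ` leaves `(1 - ζ)² w' = -3ζ w'`; the unit `1 + ζ = -ζ²` turns `-3ζ` into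
    -- `3`.
    refine ⟨⟨b₀, b₁⟩ * ⟨1, 1⟩, ?_⟩
    ext
    · simp only [QuadraticAlgebra.re_mul, QuadraticAlgebra.im_mul, QuadraticAlgebra.re_intCast,
        QuadraticAlgebra.im_intCast, Int.cast_id]
      linarith
    · simp only [QuadraticAlgebra.re_mul, QuadraticAlgebra.im_mul, QuadraticAlgebra.re_intCast,
        QuadraticAlgebra.im_intCast, Int.cast_id]
      linarith
  have hpq : ¬ (3 : ℤ) ∣ p + q := by
    rintro ⟨y, hy⟩
    refine hec ⟨3 * y ^ 2 - p * q, ?_⟩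
    obtain rfl : p = 3 * y - q := by linarith
    rw [hnorm']; ring
  have hcop : IsCoprime (e * c) (3 * (-3 * (3 + 6 * k) ^ 2)) := by
    have h3 := isCoprime_three_of_not_dvd hec
    have hw1 : IsCoprime (e * c) (3 + 6 * k) := by
      have : IsCoprime (d * e ^ 2 * c ^ 3) (3 + 6 * k) := by
        rw [← hw]
        have h1 : IsCoprime ((1 + 3 * k) ^ 2) (3 + 6 * k) :=
          IsCoprime.pow_left ⟨-2, 1, by ring⟩
        rw [show (1 + 3 * k) ^ 2 - (1 + 3 * k) * (3 + 6 * k) + (3 + 6 * k) ^ 2 =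
          (1 + 3 * k) ^ 2 + (3 + 6 * k) * ((3 + 6 * k) - (1 + 3 * k)) by ring]
        exact h1.add_mul_left_left _
      exact this.of_isCoprime_of_dvd_left ⟨d * e * c ^ 2, by ring⟩
    exact h3.mul_right ((h3.neg_right).mul_right hw1.pow_right)
  obtain ⟨k₀, k₁, h1, h2, h3⟩ := exists_cube_mul_eq (t := 3) hdvd' hnorm' hw hcop he1 he.ne' hc'.ne'
    ⟨1 + 2 * k, by ring⟩ (by omega)
  refine ⟨hpq, hde, k₀, k₁, ?_, h2, fun ε hε => ?_⟩
  · have ha : (⟨p + q, 2 * q - p⟩ : Eis) = ⟨1, -1⟩ * ⟨p, q⟩ := by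
      ext
      · simp
      · simp; ring
    have hl : (⟨1, -1⟩ : Eis) ^ 3 * ⟨1 + 3 * k, 3 + 6 * k⟩ = ⟨12 + 27 * k + 3, 3⟩ := by
      rw [eis_cube]
      ext
      · simp; ring
      · simp; ring
    rw [ha, mul_pow, mul_assoc, h1, ← hl]
    ring
  · have hε' : ε ≡ (1 + 3 * k) * (p + q) [ZMOD 3] :=
      hε.trans (Int.modEq_iff_dvd.2 ⟨k * (p + q), by ring⟩)
    exact ⟨(h3 ε hε').1, (h3 ε hε').2, ⟨ε * e * (3 * c ^ 2) - (12 + 27 * k) * q, by ring⟩⟩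

theorem exists_sign_of_not_dvd {x : ℤ} (h : ¬ (3 : ℤ) ∣ x) :
    ∃ ε : ℤ, (ε = 1 ∨ ε = -1) ∧ ε ≡ x [ZMOD 3] := by
  have : x % 3 = 1 ∨ x % 3 = 2 := by omega
  rcases this with h | h
  · exact ⟨1, Or.inl rfl, by unfold Int.ModEq; omega⟩
  · exact ⟨-1, Or.inr rfl, by unfold Int.ModEq; omega⟩

/-- The arithmetic facts about `n`, `d`, `e`, `c`, `a₀`, `a₁` behind the normal integral bases. -/
theorem shanks_arithmetic {n d e c a₀ a₁ : ℤ} (hn : ¬ (3 : ℤ) ∣ n ∨ n ≡ 12 [ZMOD 27])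
    (he : 0 < e) (hc : 0 < c)
    (hdsq : Squarefree d) (hesq : Squarefree e) (hde : IsCoprime d e)
    (hΔ : n ^ 2 + 3 * n + 9 = d * e ^ 2 * c ^ 3)
    (hnorm : e * c = a₀ ^ 2 - a₀ * a₁ + a₁ ^ 2)
    (hdvd : (⟨a₀, a₁⟩ : Eis) ∣ ⟨n + 3, 3⟩) :
    ¬ (3 : ℤ) ∣ d * e ∧ (∃ ε : ℤ, IsShanksSign n a₀ a₁ ε) ∧ ∃ k₀ k₁ : ℤ,
      (⟨a₀, a₁⟩ : Eis) ^ 3 * ⟨k₀, k₁⟩ = (e : Eis) * ⟨n + 3, 3⟩ ∧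
      k₀ ^ 2 - k₀ * k₁ + k₁ ^ 2 = d * e ∧
      ∀ ε : ℤ, IsShanksSign n a₀ a₁ ε →
        3 ∣ k₁ ∧ 3 ∣ k₀ - ε ∧ 3 ∣ ε * e * c ^ 2 - n * (a₀ + a₁) := by
  rcases hn with hn | hn
  · have hn' : ¬ n ≡ 12 [ZMOD 27] := fun h => hn (by unfold Int.ModEq at h; omega)
    obtain ⟨h1, k₀, k₁, h2, h3, h4⟩ := exists_cube_mul_eq_of_not_dvd hn he hc hΔ hnorm hdvd
    have ha : ¬ (3 : ℤ) ∣ n * (a₀ + a₁) := by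
      intro h
      obtain ⟨y, hy⟩ := (Int.prime_three.dvd_or_dvd h).resolve_left hn
      have : (3 : ℤ) ∣ d * e ^ 2 * c ^ 3 := by
        refine dvd_trans ⟨3 * y ^ 2 - a₀ * a₁, ?_⟩ (⟨d * e * c ^ 2, by ring⟩ : e * c ∣ _)
        obtain rfl : a₀ = 3 * y - a₁ := by linarith
        rw [hnorm]; ring
      rw [← hΔ] at this
      have h3 : (3 : ℤ) ∣ 3 * n + 9 := ⟨n + 3, by ring⟩
      rw [add_assoc] at this
      exact hn (Int.prime_three.dvd_of_dvd_pow ((dvd_add_left h3).1 this))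
    obtain ⟨ε, hε, hε'⟩ := exists_sign_of_not_dvd ha
    exact ⟨h1, ⟨ε, hε, fun _ => hε', fun h => absurd h hn'⟩, k₀, k₁, h2, h3,
      fun ε hε => h4 ε (hε.2.1 hn)⟩
  · have hn' : (3 : ℤ) ∣ n := by unfold Int.ModEq at hn; omega
    obtain ⟨h0, h1, k₀, k₁, h2, h3, h4⟩ :=
      exists_cube_mul_eq_of_modEq hn he hc hdsq hesq hde hΔ hnorm hdvd
    obtain ⟨ε, hε, hε'⟩ := exists_sign_of_not_dvd h0
    exact ⟨h1, ⟨ε, hε, fun h => absurd hn' h, fun _ => hε'⟩, k₀, k₁, h2, h3,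
      fun ε hε => h4 ε (hε.2.2 hn)⟩

/-! ### Lagrange resolvents and the roots of Shanks' cubic -/

section Resolvent

variable {F : Type*} [Field F] {z : F}

theorem resolvent_mul_resolvent (hz : z ^ 2 = -1 - z) (x y w : F) :
    (x + z * y + z ^ 2 * w) * (x + z ^ 2 * y + z * w) =
      (x + y + w) ^ 2 - 3 * (x * y + y * w + w * x) := by
  have h3 : z ^ 3 = 1 := by linear_combination (z - 1) * hz
  linear_combination (y ^ 2 + w ^ 2 + z * y * w) * h3 + (x * y + x * w + y * w) * hz

theorem resolvent_cube (hz : z ^ 2 = -1 - z) (x y w : F) :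
    (x + z * y + z ^ 2 * w) ^ 3 =
      (x ^ 3 + y ^ 3 + w ^ 3 + 6 * (x * y * w) - 3 * (x * y ^ 2 + y * w ^ 2 + w * x ^ 2)) +
        3 * ((x ^ 2 * y + y ^ 2 * w + w ^ 2 * x) - (x * y ^ 2 + y * w ^ 2 + w * x ^ 2)) * z := by
  have h3 : z ^ 3 = 1 := by linear_combination (z - 1) * hz
  linear_combination (y ^ 3 + (z ^ 3 + 1) * w ^ 3 + 6 * x * y * w + 3 * z * y ^ 2 * w
    + 3 * z ^ 2 * y * w ^ 2 + 3 * z * x * w ^ 2) * h3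
    + 3 * (x * y ^ 2 + y * w ^ 2 + w * x ^ 2) * hz

theorem resolvent_prod [CharZero F] (hz : z ^ 2 = -1 - z) (x y w : F) :
    27 * (x * y * w) = (x + y + w) ^ 3 + (x + z * y + z ^ 2 * w) ^ 3 + (x + z ^ 2 * y + z * w) ^ 3
      - 3 * (x + y + w) * ((x + z * y + z ^ 2 * w) * (x + z ^ 2 * y + z * w)) := by
  have hz' : (-1 - z) ^ 2 = -1 - (-1 - z) := by linear_combination hz
  rw [resolvent_mul_resolvent hz, resolvent_cube hz]
  have := resolvent_cube hz' x y w
  rw [show (-1 - z) ^ 2 = z by linear_combination hz] at this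
  rw [hz, this]
  ring

/-- The other two roots of Shanks' polynomial are polynomials in the first. -/
theorem shanksConj_eq {n : ℤ} {r : F}
    (hr : r ^ 3 - n * r ^ 2 - (n + 3) * r - 1 = 0) :
    shanksConj r = r ^ 2 - (n + 1) * r - 2 ∧
      shanksConj (shanksConj r) = n - r - (r ^ 2 - (n + 1) * r - 2) ∧
      (shanksConj r) ^ 3 - n * (shanksConj r) ^ 2 - (n + 3) * shanksConj r - 1 = 0 := by
  have key : ∀ s : F, s ^ 3 - n * s ^ 2 - (n + 3) * s - 1 = 0 →
      shanksConj s = s ^ 2 - (n + 1) * s - 2 := by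
    intro s hs
    have h1 : (1 + s) * (s ^ 2 - (n + 1) * s - 2) = -1 := by linear_combination hs
    have h2 : 1 + s ≠ 0 := by
      intro h
      rw [h, zero_mul] at h1
      simp at h1
    rw [shanksConj, div_eq_iff h2, ← h1, mul_comm]
  have h1 := key r hr
  have hr' : (shanksConj r) ^ 3 - n * (shanksConj r) ^ 2 - (n + 3) * shanksConj r - 1 = 0 := by
    have h2 : shanksConj r * (1 + r) = -1 := by rw [h1]; linear_combination hr
    have h3 : 1 + r ≠ 0 := fun h => by simp [h] at h2
    refine (mul_eq_zero.1 ?_).resolve_left (pow_ne_zero 3 h3)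
    set s := shanksConj r
    linear_combination (s ^ 2 * (1 + r) ^ 2 - s * (1 + r) + 1 - n * (1 + r) * (s * (1 + r) - 1)
      - (n + 3) * (1 + r) ^ 2) * h2 - hr
  refine ⟨h1, ?_, hr'⟩
  rw [key _ hr', h1]
  linear_combination (r - n - 2) * hr

end Resolvent

/-! ### Resolvents and integrality of the proposed generator -/

section Generator

variable {F : Type*} [Field F] {z r : F} {n d e c a₀ a₁ k₀ k₁ ε m : ℤ}

/-- `(a₀ x + a₁ y + m) / q`. -/
def shanksGen (x y : F) (a₀ a₁ m q : ℤ) : F := ((a₀ : F) * x + (a₁ : F) * y + (m : F)) / (q : F)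

theorem eis_equation_cast (hz : z ^ 2 = -1 - z)
    (hK : (⟨a₀, a₁⟩ : Eis) ^ 3 * ⟨k₀, k₁⟩ = (e : Eis) * ⟨n + 3, 3⟩) :
    (a₀ + a₁ * z : F) ^ 3 * (k₀ + k₁ * z) = e * (n + 3 + 3 * z) := by
  rw [eis_cube] at hK
  have h0 := congrArg QuadraticAlgebra.re hK
  have h1 := congrArg QuadraticAlgebra.im hK
  simp only [QuadraticAlgebra.re_mul, QuadraticAlgebra.im_mul, QuadraticAlgebra.re_intCast,
    QuadraticAlgebra.im_intCast] at h0 h1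
  have f0 := congrArg (Int.cast : ℤ → F) h0
  have f1 := congrArg (Int.cast : ℤ → F) h1
  push_cast at f0 f1
  have hc : (a₀ + a₁ * z : F) ^ 3 =
      (a₀ ^ 3 + a₁ ^ 3 - 3 * a₀ * a₁ ^ 2) + (3 * a₀ ^ 2 * a₁ - 3 * a₀ * a₁ ^ 2) * z := by
    linear_combination (3 * a₀ * a₁ ^ 2 + a₁ ^ 3 * (z - 1) : F) * hz
  rw [hc]
  linear_combination f0 + z * f1 + (3 * a₀ ^ 2 * a₁ - 3 * a₀ * a₁ ^ 2 : F) * k₁ * hz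

theorem shanks_elementary (hr : r ^ 3 - n * r ^ 2 - (n + 3) * r - 1 = 0) :
    r + shanksConj r + shanksConj (shanksConj r) = n ∧
      r * shanksConj r + shanksConj r * shanksConj (shanksConj r)
        + shanksConj (shanksConj r) * r = -(n + 3) ∧
      shanksConj (shanksConj (shanksConj r)) = r := by
  obtain ⟨h1, h2, hr'⟩ := shanksConj_eq hr
  obtain ⟨h1', h2', -⟩ := shanksConj_eq hr'
  have hs : r + shanksConj r + shanksConj (shanksConj r) = n := by rw [h2, h1]; ring
  refine ⟨hs, ?_, ?_⟩
  · rw [h2, h1]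
    linear_combination (n + 1 - r) * hr
  · rw [h2', ← h1']
    linear_combination -hs

theorem shanksConj_mul (hr : r ^ 3 - n * r ^ 2 - (n + 3) * r - 1 = 0) :
    shanksConj r * (1 + r) = -1 := by
  rw [(shanksConj_eq hr).1]
  linear_combination hr

theorem shanks_resolvent_cube (hz : z ^ 2 = -1 - z)
    (hr : r ^ 3 - n * r ^ 2 - (n + 3) * r - 1 = 0) :
    (r + z * shanksConj r + z ^ 2 * shanksConj (shanksConj r)) ^ 3 =
      (n ^ 2 + 3 * n + 9) * (n + 3 + 3 * z) := by
  have hr' := (shanksConj_eq hr).2.2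
  have m1 := shanksConj_mul hr
  have m2 := shanksConj_mul hr'
  have m3 := shanksConj_mul (shanksConj_eq hr').2.2
  obtain ⟨e1, e2, e4⟩ := shanks_elementary hr
  rw [e4] at m3
  rw [resolvent_cube hz]
  set s := shanksConj r
  set t := shanksConj s
  have e3 : r * s * t = 1 := by linear_combination r * m2 - m3
  have s1 : r * s ^ 2 + s * t ^ 2 + t * r ^ 2 = -(n ^ 2 + 3 * n + 6) := by
    linear_combination s * m1 + t * m2 + r * m3 - (1 + r + s + t + n) * e1 + 2 * e2
  have s2 : r ^ 2 * s + s ^ 2 * t + t ^ 2 * r = 3 := by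
    linear_combination r * m1 + s * m2 + t * m3 - e1 - e2
  have s3 : r ^ 3 + s ^ 3 + t ^ 3 = n ^ 3 + 3 * n ^ 2 + 9 * n + 3 := by
    linear_combination ((r + s + t) ^ 2 + (r + s + t) * n + n ^ 2 + 3 * (n + 3)) * e1
      - 3 * (r + s + t) * e2 + 3 * e3
  rw [e3, s1, s2, s3]
  ring

theorem shanksGen_sum (hr : r ^ 3 - n * r ^ 2 - (n + 3) * r - 1 = 0) {q : ℤ} (hq : (q : F) ≠ 0)
    (hm : 3 * m = ε * q - n * (a₀ + a₁)) :
    shanksGen r (shanksConj r) a₀ a₁ m q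
      + shanksGen (shanksConj r) (shanksConj (shanksConj r)) a₀ a₁ m q
      + shanksGen (shanksConj (shanksConj r)) r a₀ a₁ m q = ε := by
  obtain ⟨e1, -⟩ := shanks_elementary hr
  have hm' := congrArg (Int.cast : ℤ → F) hm
  push_cast at hm'
  simp only [shanksGen]
  field_simp
  linear_combination (a₀ + a₁ : F) * e1 + hm'

/-- A cyclic shift of the arguments multiplies the resolvent by `ζ⁻¹ = ζ²`, and the constant `m`
drops out because `1 + ζ + ζ² = 0`. The factor is therefore the conjugate of `a₀ + a₁ζ`. -/
theorem shanksGen_resolvent (hz : z ^ 2 = -1 - z) {q : ℤ} (hq : (q : F) ≠ 0) (x y w : F) :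
    q * (shanksGen x y a₀ a₁ m q + z * shanksGen y w a₀ a₁ m q
      + z ^ 2 * shanksGen w x a₀ a₁ m q) = (a₀ + a₁ * z ^ 2) * (x + z * y + z ^ 2 * w) := by
  have h3 : z ^ 3 = 1 := by linear_combination (z - 1) * hz
  simp only [shanksGen]
  field_simp
  linear_combination (m : F) * hz - a₁ * (y + z * w) * h3

theorem shanksGen_resolvent_cube [CharZero F] (hz : z ^ 2 = -1 - z)
    (hr : r ^ 3 - n * r ^ 2 - (n + 3) * r - 1 = 0)
    (he : e ≠ 0) (hc : c ≠ 0) (hΔ : n ^ 2 + 3 * n + 9 = d * e ^ 2 * c ^ 3)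
    (hnorm : e * c = a₀ ^ 2 - a₀ * a₁ + a₁ ^ 2)
    (hK : (⟨a₀, a₁⟩ : Eis) ^ 3 * ⟨k₀, k₁⟩ = (e : Eis) * ⟨n + 3, 3⟩) :
    (shanksGen r (shanksConj r) a₀ a₁ m (e * c ^ 2)
      + z * shanksGen (shanksConj r) (shanksConj (shanksConj r)) a₀ a₁ m (e * c ^ 2)
      + z ^ 2 * shanksGen (shanksConj (shanksConj r)) r a₀ a₁ m (e * c ^ 2)) ^ 3 =
      (d * e : ℤ) * (k₀ + k₁ * z) := by
  have he' : (e : F) ≠ 0 := Int.cast_ne_zero.2 he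
  have hc' : (c : F) ≠ 0 := Int.cast_ne_zero.2 hc
  have hq : ((e * c ^ 2 : ℤ) : F) ≠ 0 := Int.cast_ne_zero.2 (mul_ne_zero he (pow_ne_zero 2 hc))
  have h1 := shanksGen_resolvent (a₀ := a₀) (a₁ := a₁) (m := m) hz hq r (shanksConj r)
    (shanksConj (shanksConj r))
  set T := shanksGen r (shanksConj r) a₀ a₁ m (e * c ^ 2)
      + z * shanksGen (shanksConj r) (shanksConj (shanksConj r)) a₀ a₁ m (e * c ^ 2)
      + z ^ 2 * shanksGen (shanksConj (shanksConj r)) r a₀ a₁ m (e * c ^ 2)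
  have h2 := eis_equation_cast hz hK
  have h3 := shanks_resolvent_cube hz hr
  set S := r + z * shanksConj r + z ^ 2 * shanksConj (shanksConj r)
  have h4 : (a₀ + a₁ * z : F) * (a₀ + a₁ * z ^ 2) = e * c := by
    have := congrArg (Int.cast : ℤ → F) hnorm
    push_cast at this
    rw [this]
    linear_combination (a₀ * a₁ + a₁ ^ 2 * (z - 1) : F) * hz
  have h5 := congrArg (Int.cast : ℤ → F) hΔ
  push_cast at h1 h5 ⊢
  refine mul_left_cancel₀ (mul_ne_zero he' (pow_ne_zero 3 (by exact_mod_cast hq :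
    ((e : F) * c ^ 2) ≠ 0))) ?_
  calc (e : F) * (e * c ^ 2) ^ 3 * T ^ 3 = e * (e * c ^ 2 * T) ^ 3 := by ring
    _ = (a₀ + a₁ * z ^ 2) ^ 3 * (n ^ 2 + 3 * n + 9) * (e * (n + 3 + 3 * z)) := by
      rw [h1, mul_pow, h3]; ring
    _ = ((a₀ + a₁ * z) * (a₀ + a₁ * z ^ 2)) ^ 3 * (n ^ 2 + 3 * n + 9) * (k₀ + k₁ * z) := by
      rw [← h2]; ring
    _ = e * (e * c ^ 2) ^ 3 * (d * e * (k₀ + k₁ * z)) := by rw [h4, h5]; ring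

theorem shanksGen_resolvent_norm [CharZero F] (hz : z ^ 2 = -1 - z)
    (hr : r ^ 3 - n * r ^ 2 - (n + 3) * r - 1 = 0)
    (he : e ≠ 0) (hc : c ≠ 0) (hΔ : n ^ 2 + 3 * n + 9 = d * e ^ 2 * c ^ 3)
    (hnorm : e * c = a₀ ^ 2 - a₀ * a₁ + a₁ ^ 2) :
    (shanksGen r (shanksConj r) a₀ a₁ m (e * c ^ 2)
      + z * shanksGen (shanksConj r) (shanksConj (shanksConj r)) a₀ a₁ m (e * c ^ 2)
      + z ^ 2 * shanksGen (shanksConj (shanksConj r)) r a₀ a₁ m (e * c ^ 2)) *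
    (shanksGen r (shanksConj r) a₀ a₁ m (e * c ^ 2)
      + z ^ 2 * shanksGen (shanksConj r) (shanksConj (shanksConj r)) a₀ a₁ m (e * c ^ 2)
      + z * shanksGen (shanksConj (shanksConj r)) r a₀ a₁ m (e * c ^ 2)) = (d * e : ℤ) := by
  have hz' : (z ^ 2) ^ 2 = -1 - z ^ 2 := by linear_combination (z ^ 2 - z + 1) * hz
  have hz4 : (z ^ 2) ^ 2 = z := by linear_combination (z ^ 2 - z) * hz
  have hq : ((e * c ^ 2 : ℤ) : F) ≠ 0 := Int.cast_ne_zero.2 (mul_ne_zero he (pow_ne_zero 2 hc))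
  have h1 := shanksGen_resolvent (a₀ := a₀) (a₁ := a₁) (m := m) hz hq r (shanksConj r)
    (shanksConj (shanksConj r))
  have h2 := shanksGen_resolvent (a₀ := a₀) (a₁ := a₁) (m := m) hz' hq r (shanksConj r)
    (shanksConj (shanksConj r))
  rw [hz4] at h2
  obtain ⟨e1, e2, -⟩ := shanks_elementary hr
  have h3 := resolvent_mul_resolvent hz r (shanksConj r) (shanksConj (shanksConj r))
  rw [e1, e2] at h3
  have h4 : (a₀ + a₁ * z : F) * (a₀ + a₁ * z ^ 2) = e * c := by
    have := congrArg (Int.cast : ℤ → F) hnorm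
    push_cast at this
    rw [this]
    linear_combination (a₀ * a₁ + a₁ ^ 2 * (z - 1) : F) * hz
  have h5 := congrArg (Int.cast : ℤ → F) hΔ
  refine mul_left_cancel₀ (mul_ne_zero hq hq) ?_
  rw [mul_mul_mul_comm, h1, h2, mul_mul_mul_comm, h3, mul_comm (a₀ + a₁ * z ^ 2 : F), h4]
  push_cast at h5 ⊢
  linear_combination (e * c : F) * h5

/-- A field element whose conjugates have the right sum and resolvents is an algebraic integer. -/
theorem isIntegral_of_resolvents [CharZero F] {D : ℤ} {x y w : F} (hz : z ^ 2 = -1 - z)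
    (hε : ε = 1 ∨ ε = -1) (hsum : x + y + w = ε)
    (hprod : (x + z * y + z ^ 2 * w) * (x + z ^ 2 * y + z * w) = D)
    (hcube : (x + z * y + z ^ 2 * w) ^ 3 = D * (k₀ + k₁ * z))
    (hcube' : (x + z ^ 2 * y + z * w) ^ 3 = D * (k₀ + k₁ * z ^ 2))
    (hD : k₀ ^ 2 - k₀ * k₁ + k₁ ^ 2 = D) (h1 : 3 ∣ k₁) (h0 : 3 ∣ k₀ - ε) : IsIntegral ℤ x := by
  obtain ⟨t, rfl⟩ := h1
  obtain ⟨s, hs⟩ := h0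
  obtain rfl : k₀ = ε + 3 * s := by linarith
  have hε2 : ε ^ 2 = 1 := by rcases hε with rfl | rfl <;> rfl
  obtain ⟨u, hu⟩ : ∃ u : ℤ, ε ^ 2 - D = 3 * u := ⟨-(2 * ε * s + 3 * s ^ 2 - (ε + 3 * s) * t
    + 3 * t ^ 2), by rw [← hD]; ring⟩
  obtain ⟨v, hv⟩ : ∃ v : ℤ, ε ^ 3 + D * (2 * (ε + 3 * s) - 3 * t) - 3 * ε * D = 27 * v := by
    -- With `r = 2s - t` and `Q = s² - st + t²`, one has `D = ε² + 3εr + 9Q`, and the left side is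
    -- `ε³ + D(3r - ε) = 9ε(r² - Q) + 27Qr`, where `r² - Q = 3(s² - st)`.
    refine ⟨ε * (s ^ 2 - s * t) + (s ^ 2 - s * t + t ^ 2) * (2 * s - t), ?_⟩
    rw [← hD]
    rcases hε with rfl | rfl <;> ring
  have hprod' := resolvent_mul_resolvent hz x y w
  have h27 := resolvent_prod hz x y w
  rw [hprod, hcube, hcube', hsum] at h27
  rw [hprod, hsum] at hprod'
  have fu := congrArg (Int.cast : ℤ → F) hu
  have fv := congrArg (Int.cast : ℤ → F) hv
  push_cast at fu fv h27
  have e2 : x * y + y * w + w * x = u := by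
    refine mul_left_cancel₀ (three_ne_zero (α := F)) ?_
    linear_combination fu + hprod'
  have e3 : x * y * w = v := by
    refine mul_left_cancel₀ (by norm_num : (27 : F) ≠ 0) ?_
    rw [h27, ← fv, hz]
    ring
  refine ⟨X ^ 3 - C ε * X ^ 2 + C u * X - C v, by monicity!, ?_⟩
  simp only [eval₂_sub, eval₂_add, eval₂_mul, eval₂_pow, eval₂_X, eval₂_C, algebraMap_int_eq,
    Int.coe_castRingHom]
  rw [← hsum, ← e2, ← e3]
  ring

end Generator

/-! ### The conjugates of the generator span the ring of integers -/

/-- The hypotheses say that `D` divides `π³` for `π = p + qζ`. Being squarefree, `D` divides the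
norm of `π`, then its trace `2p - q` by `Tr(π)³ = Tr(π³) + 3 N(π) Tr(π)`. The same identity for
`ζπ`, which has the same cube, gives `D ∣ p + q`; finally 3 is invertible mod `D`. -/
theorem squarefree_dvd_of_dvd_cube {D p q : ℤ} (hD : Squarefree D) (h3 : ¬ (3 : ℤ) ∣ D)
    (h0 : D ∣ p ^ 3 + q ^ 3 - 3 * p * q ^ 2) (h1 : D ∣ 3 * p ^ 2 * q - 3 * p * q ^ 2) :
    D ∣ p ∧ D ∣ q := by
  have hN : D ∣ p ^ 2 - p * q + q ^ 2 := by
    rw [← hD.dvd_pow_iff_dvd (n := 3) (by norm_num)]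
    have : (p ^ 2 - p * q + q ^ 2) ^ 3 =
        (p ^ 3 + q ^ 3 - 3 * p * q ^ 2) * (p ^ 3 + q ^ 3 - 3 * p ^ 2 * q)
        + (3 * p ^ 2 * q - 3 * p * q ^ 2) * (3 * p ^ 2 * q - 3 * p * q ^ 2) := by ring
    rw [this]
    exact dvd_add (h0.mul_right _) (h1.mul_right _)
  have ht : D ∣ 2 * p - q := by
    rw [← hD.dvd_pow_iff_dvd (n := 3) (by norm_num)]
    have : (2 * p - q) ^ 3 = (p ^ 3 + q ^ 3 - 3 * p * q ^ 2) * 2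
        - (3 * p ^ 2 * q - 3 * p * q ^ 2) + (p ^ 2 - p * q + q ^ 2) * (3 * (2 * p - q)) := by ring
    rw [this]
    exact dvd_add (dvd_sub (h0.mul_right _) h1) (hN.mul_right _)
  have hs : D ∣ p + q := by
    rw [← hD.dvd_pow_iff_dvd (n := 3) (by norm_num)]
    have : (p + q) ^ 3 = (3 * p ^ 2 * q - 3 * p * q ^ 2) - (p ^ 3 + q ^ 3 - 3 * p * q ^ 2) * 2
        + (p ^ 2 - p * q + q ^ 2) * (3 * (p + q)) := by ring
    rw [this]
    exact dvd_add (dvd_sub h1 (h0.mul_right _)) (hN.mul_right _)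
  have hp : D ∣ p := by
    refine (isCoprime_three_of_not_dvd h3).dvd_of_dvd_mul_left ?_
    have := dvd_add ht hs
    rwa [show 2 * p - q + (p + q) = 3 * p by ring] at this
  exact ⟨hp, (dvd_add_right hp).1 hs⟩

section Cyclic

variable {L : Type*} [Field L] [Algebra ℚ L] {σ : L ≃ₐ[ℚ] L} {D ε k₀ k₁ : ℤ} {α : L}

theorem exists_int_of_fixed (hfix : ∀ x : L, σ x = x → x ∈ Set.range (algebraMap ℚ L))
    {x : L} (hx : IsIntegral ℤ x) (h : σ x = x) : ∃ k : ℤ, x = k := by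
  have : CharZero L := charZero_of_injective_algebraMap (algebraMap ℚ L).injective
  obtain ⟨y, rfl⟩ := hfix x h
  have hy : IsIntegral ℤ y := (isIntegral_algebraMap_iff (algebraMap ℚ L).injective).1 hx
  obtain ⟨k, rfl⟩ := IsIntegrallyClosed.isIntegral_iff.1 hy
  exact ⟨k, by simp⟩

theorem isIntegral_conj (σ : L ≃ₐ[ℚ] L) {x : L} (hx : IsIntegral ℤ x) : IsIntegral ℤ (σ x) := by
  exact hx.map (σ.toAlgHom.restrictScalars ℤ)

/-- Cramer's rule for the circulant matrix of the conjugates of `α`: up to sign, its determinant is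
the trace `ε` times `D`, and the numerators are traces of algebraic integers, hence integers. -/
theorem exists_int_combination_eq_mul (hσ : ∀ x, σ (σ (σ x)) = x)
    (hfix : ∀ x : L, σ x = x → x ∈ Set.range (algebraMap ℚ L))
    (hε : ε = 1 ∨ ε = -1) (hα : IsIntegral ℤ α) (hsum : α + σ α + σ (σ α) = ε)
    (hprod : (α + σ α + σ (σ α)) ^ 2 - 3 * (α * σ α + σ α * σ (σ α) + σ (σ α) * α) = D)
    {β : L} (hβ : IsIntegral ℤ β) :
    ∃ X Y Z : ℤ, D * β = X * α + Y * σ α + Z * σ (σ α) := by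
  have key : ∀ b : L, IsIntegral ℤ b → ∃ k : ℤ, b * (σ α * σ (σ α) - α ^ 2)
      + σ b * (α * σ (σ α) - σ α ^ 2) + σ (σ b) * (α * σ α - σ (σ α) ^ 2) = k := by
    intro b hb
    refine exists_int_of_fixed hfix ?_ ?_
    · have h1 := isIntegral_conj σ hα
      have h2 := isIntegral_conj σ h1
      have h3 := isIntegral_conj σ hb
      have h4 := isIntegral_conj σ h3
      exact ((hb.mul ((h1.mul h2).sub (hα.pow 2))).add (h3.mul ((hα.mul h2).sub (h1.pow 2)))).add
        (h4.mul ((hα.mul h1).sub (h2.pow 2)))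
    · simp only [map_add, map_mul, map_sub, map_pow, hσ]
      ring
  obtain ⟨X, hX⟩ := key β hβ
  -- For the cofactor `c = σα σ²α - α²`, the coefficient of `σ²α` needs `Tr(β σ²c) = Tr(σβ c)`, and
  -- that of `σα` needs `Tr(β σc) = Tr(σ²β c)`.
  obtain ⟨Z, hZ⟩ := key (σ β) (isIntegral_conj σ hβ)
  obtain ⟨Y, hY⟩ := key (σ (σ β)) (isIntegral_conj σ (isIntegral_conj σ hβ))
  simp only [hσ] at hX hY hZ
  refine ⟨-ε * X, -ε * Y, -ε * Z, ?_⟩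
  have hε2 : (ε : L) ^ 2 = 1 := by rcases hε with rfl | rfl <;> simp
  push_cast
  rw [← hX, ← hY, ← hZ, ← hprod, ← one_mul (_ * β), ← hε2, ← hsum]
  ring

theorem exists_int_combination (hσ : ∀ x, σ (σ (σ x)) = x)
    (hfix : ∀ x : L, σ x = x → x ∈ Set.range (algebraMap ℚ L)) (ι : L →+* ℂ)
    (hDsq : Squarefree D) (hD3 : ¬ (3 : ℤ) ∣ D)
    (hε : ε = 1 ∨ ε = -1) (hα : IsIntegral ℤ α) (hsum : α + σ α + σ (σ α) = ε)
    (hprod : (α + σ α + σ (σ α)) ^ 2 - 3 * (α * σ α + σ α * σ (σ α) + σ (σ α) * α) = D)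
    (hcube : (ι α + zetaThree * ι (σ α) + zetaThree ^ 2 * ι (σ (σ α))) ^ 3 =
      D * (k₀ + k₁ * zetaThree))
    (hK : k₀ ^ 2 - k₀ * k₁ + k₁ ^ 2 = D)
    {β : L} (hβ : IsIntegral ℤ β) :
    ∃ X Y Z : ℤ, β = X * α + Y * σ α + Z * σ (σ α) := by
  have : CharZero L := charZero_of_injective_algebraMap (algebraMap ℚ L).injective
  obtain ⟨X, Y, Z, hXYZ⟩ := exists_int_combination_eq_mul hσ hfix hε hα hsum hprod hβ
  have hD0 : D ≠ 0 := hDsq.ne_zero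
  have hDC : (D : ℂ) ≠ 0 := Int.cast_ne_zero.2 hD0
  have hDL : (D : L) ≠ 0 := Int.cast_ne_zero.2 hD0
  have hβ1 := isIntegral_conj σ hβ
  have hβ2 := isIntegral_conj σ hβ1
  have hXYZ1 := congrArg σ hXYZ
  have hXYZ2 := congrArg σ hXYZ1
  simp only [map_mul, map_add, map_intCast, hσ] at hXYZ1 hXYZ2
  obtain ⟨t, ht⟩ : ∃ t : ℤ, β + σ β + σ (σ β) = t :=
    exists_int_of_fixed hfix ((hβ.add hβ1).add hβ2) (by simp only [map_add, hσ]; ring)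
  have h3 : IsIntegral ℤ (3 : L) := by
    simpa using isIntegral_algebraMap (R := ℤ) (A := L) (x := 3)
  have h6 : IsIntegral ℤ (6 : L) := by
    simpa using isIntegral_algebraMap (R := ℤ) (A := L) (x := 6)
  -- `u` and `v` are the coordinates of the cube of the resolvent of `β`; both are integral and
  -- fixed by `σ`.
  obtain ⟨u, hu⟩ : ∃ u : ℤ, β ^ 3 + σ β ^ 3 + σ (σ β) ^ 3 + 6 * (β * σ β * σ (σ β))
      - 3 * (β * σ β ^ 2 + σ β * σ (σ β) ^ 2 + σ (σ β) * β ^ 2) = u := by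
    refine exists_int_of_fixed hfix ?_ ?_
    · exact ((((hβ.pow 3).add (hβ1.pow 3)).add (hβ2.pow 3)).add (h6.mul ((hβ.mul hβ1).mul hβ2))).sub
        (h3.mul (((hβ.mul (hβ1.pow 2)).add (hβ1.mul (hβ2.pow 2))).add (hβ2.mul (hβ.pow 2))))
    · simp only [map_add, map_mul, map_sub, map_pow, map_ofNat, hσ]
      ring
  obtain ⟨v, hv⟩ : ∃ v : ℤ, 3 * ((β ^ 2 * σ β + σ β ^ 2 * σ (σ β) + σ (σ β) ^ 2 * β)
      - (β * σ β ^ 2 + σ β * σ (σ β) ^ 2 + σ (σ β) * β ^ 2)) = v := by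
    refine exists_int_of_fixed hfix ?_ ?_
    · exact h3.mul (((((hβ.pow 2).mul hβ1).add ((hβ1.pow 2).mul hβ2)).add ((hβ2.pow 2).mul hβ)).sub
        (((hβ.mul (hβ1.pow 2)).add (hβ1.mul (hβ2.pow 2))).add (hβ2.mul (hβ.pow 2))))
    · simp only [map_add, map_mul, map_sub, map_pow, map_ofNat, hσ]
      ring
  have hz := zetaThree_sq
  have hz3 : zetaThree ^ 3 = 1 := by linear_combination (zetaThree - 1) * hz
  have hcubeβ := resolvent_cube hz (ι β) (ι (σ β)) (ι (σ (σ β)))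
  have hu' := congrArg ι hu
  have hv' := congrArg ι hv
  simp only [map_add, map_mul, map_sub, map_pow, map_ofNat, map_intCast] at hu' hv'
  rw [hu', hv'] at hcubeβ
  have f0 := congrArg ι hXYZ
  have f1 := congrArg ι hXYZ1
  have f2 := congrArg ι hXYZ2
  simp only [map_add, map_mul, map_intCast] at f0 f1 f2
  set z := zetaThree
  set T := ι α + z * ι (σ α) + z ^ 2 * ι (σ (σ α))
  set S := ι β + z * ι (σ β) + z ^ 2 * ι (σ (σ β))
  have hTS : D * S = ((X - Y : ℤ) + (Z - Y : ℤ) * z) * T := by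
    have : D * S = (X + Y * z ^ 2 + Z * z) * T := by
      simp only [S, T]
      linear_combination f0 + z * f1 + z ^ 2 * f2
        - (Y * ι (σ α) + (Z + Y * z) * ι (σ (σ α))) * hz3
    rw [this, hz]
    push_cast
    ring
  -- Cubing `D S = (p + qζ) T` and multiplying by `K̄` gives `D³ S³ K̄ = (p + qζ)³ D²`, so `D`
  -- divides `(p + qζ)³` in `ℤ[ζ]`.
  have hQ : (((X - Y : ℤ) : ℂ) + (Z - Y : ℤ) * z) ^ 3 = D * ((u + v * z) * (k₀ + k₁ * z ^ 2)) := by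
    have hKC : ((k₀ : ℂ) + k₁ * z) * (k₀ + k₁ * z ^ 2) = D := by
      rw [← hK]
      push_cast
      linear_combination (k₀ * k₁ + k₁ ^ 2 * (z - 1) : ℂ) * hz
    have h1 := congrArg (· ^ 3) hTS
    simp only [mul_pow] at h1
    rw [hcube, hcubeβ] at h1
    refine mul_left_cancel₀ (mul_ne_zero hDC hDC) ?_
    calc (D : ℂ) * D * (((X - Y : ℤ) : ℂ) + (Z - Y : ℤ) * z) ^ 3
        = ((((X - Y : ℤ) : ℂ) + (Z - Y : ℤ) * z) ^ 3 * (D * (k₀ + k₁ * z))) * (k₀ + k₁ * z ^ 2) := by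
          rw [← hKC]; ring
      _ = _ := by rw [← h1]; ring
  set p := X - Y
  set q := Z - Y
  have hcoord := add_mul_zetaThree_inj (x := p ^ 3 + q ^ 3 - 3 * p * q ^ 2)
    (y := 3 * p ^ 2 * q - 3 * p * q ^ 2) (u := D * (u * k₀ - u * k₁ + v * k₁))
    (v := D * (v * k₀ - u * k₁)) (by
      push_cast
      linear_combination hQ - (3 * p * q ^ 2 + q ^ 3 * (z - 1) : ℂ) * hz
        + D * (u * k₁ + v * k₁ * (z - 1)) * hz)
  obtain ⟨hp, hq⟩ := squarefree_dvd_of_dvd_cube hDsq hD3 ⟨_, hcoord.1⟩ ⟨_, hcoord.2⟩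
  -- Taking traces in `Dβ = Xα + Yσα + Zσ²α` gives `D t = (X + Y + Z) ε`.
  have hs : D ∣ X + Y + Z := by
    have hε2 : (ε : L) ^ 2 = 1 := by rcases hε with rfl | rfl <;> simp
    refine ⟨t * ε, ?_⟩
    have : ((X + Y + Z : ℤ) : L) = ((D * (t * ε) : ℤ) : L) := by
      push_cast
      rw [← ht]
      linear_combination (-(X + Y + Z : L)) * hε2 - (ε : L) * (hXYZ + hXYZ1 + hXYZ2)
        - (ε : L) * (X + Y + Z) * hsum
    exact_mod_cast this
  have hY : D ∣ Y := by
    refine (isCoprime_three_of_not_dvd hD3).dvd_of_dvd_mul_left ?_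
    have := dvd_sub (dvd_sub hs hp) hq
    rwa [show X + Y + Z - p - q = 3 * Y by simp only [p, q]; ring] at this
  obtain ⟨x, hx⟩ := (dvd_sub_left hY).1 hp
  obtain ⟨y, hy⟩ := hY
  obtain ⟨w, hw⟩ := (dvd_sub_left ⟨y, hy⟩).1 hq
  refine ⟨x, y, w, mul_left_cancel₀ hDL ?_⟩
  rw [hXYZ, hx, hy, hw]
  push_cast
  ring

theorem int_combination_eq_zero (hσ : ∀ x, σ (σ (σ x)) = x)
    (hε : ε = 1 ∨ ε = -1) (hD : D ≠ 0) (hsum : α + σ α + σ (σ α) = ε)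
    (hprod : (α + σ α + σ (σ α)) ^ 2 - 3 * (α * σ α + σ α * σ (σ α) + σ (σ α) * α) = D)
    {X Y Z : ℤ} (h : X * α + Y * σ α + Z * σ (σ α) = 0) : X = 0 ∧ Y = 0 ∧ Z = 0 := by
  have : CharZero L := charZero_of_injective_algebraMap (algebraMap ℚ L).injective
  have h1 := congrArg σ h
  have h2 := congrArg σ h1
  simp only [map_add, map_mul, map_intCast, map_zero, hσ] at h1 h2
  have hdet : (ε * D : L) ≠ 0 := by
    rw [← Int.cast_mul]
    refine Int.cast_ne_zero.2 (mul_ne_zero ?_ hD)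
    rcases hε with rfl | rfl <;> norm_num
  rw [← hprod, ← hsum] at hdet
  refine ⟨?_, ?_, ?_⟩
  · have : (X : L) = 0 := by
      refine (mul_eq_zero.1 ?_).resolve_left hdet
      linear_combination (α ^ 2 - σ α * σ (σ α)) * h + (σ α ^ 2 - α * σ (σ α)) * h1
        + (σ (σ α) ^ 2 - α * σ α) * h2
    exact_mod_cast this
  · have : (Y : L) = 0 := by
      refine (mul_eq_zero.1 ?_).resolve_left hdet
      linear_combination (σ α ^ 2 - α * σ (σ α)) * h + (σ (σ α) ^ 2 - α * σ α) * h1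
        + (α ^ 2 - σ α * σ (σ α)) * h2
    exact_mod_cast this
  · have : (Z : L) = 0 := by
      refine (mul_eq_zero.1 ?_).resolve_left hdet
      linear_combination (σ (σ α) ^ 2 - α * σ α) * h + (α ^ 2 - σ α * σ (σ α)) * h1
        + (σ α ^ 2 - α * σ (σ α)) * h2
    exact_mod_cast this

end Cyclic

/-! ### Units of `ℤ[C₃]` and the count of normal integral bases -/

/-- The units of the group ring `ℤ[C₃]` are `±` the group elements. -/
theorem units_cyclic_three {X Y Z X' Y' Z' : ℤ} (h0 : X' * X + Y' * Z + Z' * Y = 1)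
    (h1 : X' * Y + Y' * X + Z' * Z = 0) (h2 : X' * Z + Y' * Y + Z' * X = 0) :
    ∃ s : ℤ, (s = 1 ∨ s = -1) ∧ ((X = s ∧ Y = 0 ∧ Z = 0) ∨ (X = 0 ∧ Y = s ∧ Z = 0) ∨
      (X = 0 ∧ Y = 0 ∧ Z = s)) := by
  have hs : (X + Y + Z) * (X' + Y' + Z') = 1 := by linear_combination h0 + h1 + h2
  have hs1 := Int.eq_one_or_neg_one_of_mul_eq_one hs
  -- This form is the norm of `X + Yζ + Zζ²`, hence multiplicative under the group ring product; it
  -- is half a sum of squares, so the value `-1` is impossible.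
  have hN : (X ^ 2 + Y ^ 2 + Z ^ 2 - X * Y - Y * Z - Z * X) *
      (X' ^ 2 + Y' ^ 2 + Z' ^ 2 - X' * Y' - Y' * Z' - Z' * X') = 1 := by
    have : (X' * X + Y' * Z + Z' * Y) ^ 2 + (X' * Y + Y' * X + Z' * Z) ^ 2
      + (X' * Z + Y' * Y + Z' * X) ^ 2
      - (X' * X + Y' * Z + Z' * Y) * (X' * Y + Y' * X + Z' * Z)
      - (X' * Y + Y' * X + Z' * Z) * (X' * Z + Y' * Y + Z' * X)
      - (X' * Z + Y' * Y + Z' * X) * (X' * X + Y' * Z + Z' * Y) = 1 := by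
      rw [h0, h1, h2]; norm_num
    rw [← this]; ring
  have hN1 : X ^ 2 + Y ^ 2 + Z ^ 2 - X * Y - Y * Z - Z * X = 1 := by
    refine (Int.eq_one_or_neg_one_of_mul_eq_one hN).resolve_right fun h => ?_
    nlinarith [sq_nonneg (X - Y), sq_nonneg (Y - Z), sq_nonneg (Z - X)]
  have hs2 : (X + Y + Z) ^ 2 = 1 := by rcases hs1 with h | h <;> rw [h] <;> rfl
  -- The square of the sum plus twice the form equals `3(X² + Y² + Z²)`.
  have hsq : X ^ 2 + Y ^ 2 + Z ^ 2 = 1 := by linarith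
  have hX : -1 ≤ X ∧ X ≤ 1 := ⟨by nlinarith, by nlinarith⟩
  have hY : -1 ≤ Y ∧ Y ≤ 1 := ⟨by nlinarith, by nlinarith⟩
  have hZ : -1 ≤ Z ∧ Z ≤ 1 := ⟨by nlinarith, by nlinarith⟩
  refine ⟨X + Y + Z, hs1, ?_⟩
  obtain ⟨hX1, hX2⟩ := hX
  obtain ⟨hY1, hY2⟩ := hY
  obtain ⟨hZ1, hZ2⟩ := hZ
  interval_cases X <;> interval_cases Y <;> simp_all <;> omega

section NormalIntegralBases

open NumberField

variable {L : Type*} [Field L] [Algebra ℚ L] {σ : L ≃ₐ[ℚ] L}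

theorem range_galois_apply (e : Fin 3 ≃ (L ≃ₐ[ℚ] L)) (he0 : e 0 = 1)
    (he1 : e 1 = σ) (he2 : e 2 = σ * σ) (x : L) :
    (Set.range fun τ : L ≃ₐ[ℚ] L => τ x) = {x, σ x, σ (σ x)} := by
  ext y
  simp only [Set.mem_insert_iff, Set.mem_singleton_iff, Set.mem_range]
  constructor
  · rintro ⟨τ, rfl⟩
    obtain ⟨i, rfl⟩ := e.surjective τ
    fin_cases i
    · left; simp [he0]
    · right; left; simp [he1]
    · right; right; simp [he2]
  · rintro (rfl | rfl | rfl)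
    · exact ⟨1, rfl⟩
    · exact ⟨σ, rfl⟩
    · exact ⟨σ * σ, rfl⟩

theorem isNormalIntegralBasis_of_combination (e : Fin 3 ≃ (L ≃ₐ[ℚ] L)) (he0 : e 0 = 1)
    (he1 : e 1 = σ) (he2 : e 2 = σ * σ) {α : L} (hα : IsIntegral ℤ α)
    (hspan : ∀ β : L, IsIntegral ℤ β → ∃ X Y Z : ℤ, β = X * α + Y * σ α + Z * σ (σ α))
    (hind : ∀ X Y Z : ℤ, X * α + Y * σ α + Z * σ (σ α) = 0 → X = 0 ∧ Y = 0 ∧ Z = 0) :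
    IsNormalIntegralBasis L {α, σ α, σ (σ α)} := by
  let v : (L ≃ₐ[ℚ] L) → 𝓞 L := fun τ => ⟨τ α, isIntegral_conj τ hα⟩
  have hv : ∀ f : Fin 3 → ℤ, ((∑ i, f i • v (e i) : 𝓞 L) : L) =
      f 0 * α + f 1 * σ α + f 2 * σ (σ α) := by
    intro f
    simp only [Fin.sum_univ_three, he0, he1, he2, zsmul_eq_mul, map_add, map_mul, map_intCast]
    rfl
  have hli : LinearIndependent ℤ (v ∘ e) := by
    rw [Fintype.linearIndependent_iff]
    intro g hg
    have h := hv g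
    simp only [Function.comp_apply] at hg
    rw [hg] at h
    obtain ⟨h0, h1, h2⟩ := hind _ _ _ h.symm
    intro i
    fin_cases i <;> assumption
  have hsp : ⊤ ≤ Submodule.span ℤ (Set.range (v ∘ e)) := by
    intro β _
    obtain ⟨X, Y, Z, h⟩ := hspan (β : L) β.2
    rw [Submodule.mem_span_range_iff_exists_fun]
    refine ⟨![X, Y, Z], RingOfIntegers.ext ?_⟩
    rw [h]
    exact hv ![X, Y, Z]
  refine ⟨⟨α, hα⟩, (Module.Basis.mk hli hsp).reindex e, fun τ => ?_, ?_⟩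
  · rw [Module.Basis.reindex_apply, Module.Basis.mk_apply, Function.comp_apply, e.apply_symm_apply]
    rfl
  · exact (range_galois_apply e he0 he1 he2 α).symm

theorem eq_or_eq_neg_of_isNormalIntegralBasis (e : Fin 3 ≃ (L ≃ₐ[ℚ] L)) (he0 : e 0 = 1)
    (he1 : e 1 = σ) (he2 : e 2 = σ * σ) (hσ : ∀ x, σ (σ (σ x)) = x) {α : L} (hα : IsIntegral ℤ α)
    (hspan : ∀ β : L, IsIntegral ℤ β → ∃ X Y Z : ℤ, β = X * α + Y * σ α + Z * σ (σ α))
    (hind : ∀ X Y Z : ℤ, X * α + Y * σ α + Z * σ (σ α) = 0 → X = 0 ∧ Y = 0 ∧ Z = 0)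
    {B : Set L} (hB : IsNormalIntegralBasis L B) :
    B = {α, σ α, σ (σ α)} ∨ B = {-α, -σ α, -σ (σ α)} := by
  obtain ⟨β, b, hb, rfl⟩ := hB
  obtain ⟨X, Y, Z, hβ⟩ := hspan (β : L) β.2
  obtain ⟨X', Y', Z', hα'⟩ : ∃ X' Y' Z' : ℤ,
      α = X' * (β : L) + Y' * σ (β : L) + Z' * σ (σ (β : L)) := by
    have h := (b.reindex e.symm).sum_equivFun ⟨α, hα⟩
    have h' := congrArg (fun x : 𝓞 L => (x : L)) h
    simp only [Fin.sum_univ_three, zsmul_eq_mul, map_add, map_mul, map_intCast,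
      Module.Basis.reindex_apply, Equiv.symm_symm, hb, he0, he1, he2] at h'
    exact ⟨_, _, _, h'.symm⟩
  have hβ1 := congrArg σ hβ
  have hβ2 := congrArg σ hβ1
  simp only [map_mul, map_add, map_intCast, hσ] at hβ1 hβ2
  -- Substituting one change of basis into the other, independence says that the two coefficient
  -- vectors are inverse in `ℤ[C₃]`.
  obtain ⟨e0, e1, e2⟩ := hind (X' * X + Y' * Z + Z' * Y - 1) (X' * Y + Y' * X + Z' * Z)
    (X' * Z + Y' * Y + Z' * X) (by
      push_cast
      linear_combination -hα' - X' * hβ - Y' * hβ1 - Z' * hβ2)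
  obtain ⟨s, hs, h⟩ := units_cyclic_three (by linarith) e1 e2
  rw [range_galois_apply e he0 he1 he2, hβ2, hβ1, hβ]
  rcases hs with rfl | rfl
  · left
    rcases h with ⟨rfl, rfl, rfl⟩ | ⟨rfl, rfl, rfl⟩ | ⟨rfl, rfl, rfl⟩ <;> ext x <;> simp <;> tauto
  · right
    rcases h with ⟨rfl, rfl, rfl⟩ | ⟨rfl, rfl, rfl⟩ | ⟨rfl, rfl, rfl⟩ <;> ext x <;> simp <;> tauto

theorem setOf_isNormalIntegralBasis (e : Fin 3 ≃ (L ≃ₐ[ℚ] L)) (he0 : e 0 = 1)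
    (he1 : e 1 = σ) (he2 : e 2 = σ * σ) (hσ : ∀ x, σ (σ (σ x)) = x) {α : L} (hα : IsIntegral ℤ α)
    (hspan : ∀ β : L, IsIntegral ℤ β → ∃ X Y Z : ℤ, β = X * α + Y * σ α + Z * σ (σ α))
    (hind : ∀ X Y Z : ℤ, X * α + Y * σ α + Z * σ (σ α) = 0 → X = 0 ∧ Y = 0 ∧ Z = 0) :
    {B : Set L | IsNormalIntegralBasis L B} =
      {{α, σ α, σ (σ α)}, {-α, -σ α, -σ (σ α)}} := by
  ext B
  simp only [Set.mem_ofPred_eq, Set.mem_insert_iff, Set.mem_singleton_iff]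
  constructor
  · exact eq_or_eq_neg_of_isNormalIntegralBasis e he0 he1 he2 hσ hα hspan hind
  · rintro (rfl | rfl)
    · exact isNormalIntegralBasis_of_combination e he0 he1 he2 hα hspan hind
    · have := isNormalIntegralBasis_of_combination e he0 he1 he2 (α := -α) hα.neg
        (fun β hβ => by
          obtain ⟨X, Y, Z, h⟩ := hspan β hβ
          exact ⟨-X, -Y, -Z, by rw [h]; push_cast; simp only [map_neg]; ring⟩)
        (fun X Y Z h => hind X Y Z (by simp only [map_neg] at h; linear_combination -h))
      simpa only [map_neg] using this

theorem triple_ne_neg_triple {F : Type*} [Field F] {α x y : F}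
    (hind : ∀ X Y Z : ℤ, X * α + Y * x + Z * y = 0 → X = 0 ∧ Y = 0 ∧ Z = 0) :
    ({α, x, y} : Set F) ≠ {-α, -x, -y} := by
  intro h
  have hmem : α ∈ ({-α, -x, -y} : Set F) := by
    rw [← h]; simp
  simp only [Set.mem_insert_iff, Set.mem_singleton_iff] at hmem
  rcases hmem with h | h | h
  · have := hind 2 0 0 (by push_cast; linear_combination h)
    omega
  · have := hind 1 1 0 (by push_cast; linear_combination h)
    omega
  · have := hind 1 0 1 (by push_cast; linear_combination h)
    omega

end NormalIntegralBases

/-! ### Irreducibility of Shanks' cubic and its Galois group -/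

theorem shanksPoly_monic (n : ℤ) : (shanksPoly n).Monic := by
  unfold shanksPoly; monicity!

theorem shanksPoly_natDegree (n : ℤ) : (shanksPoly n).natDegree = 3 := by
  unfold shanksPoly; compute_degree!

theorem aeval_shanksPoly {A : Type*} [CommRing A] (n : ℤ) (x : A) :
    aeval x (shanksPoly n) = x ^ 3 - n * x ^ 2 - (n + 3) * x - 1 := by
  simp only [shanksPoly, map_sub, map_mul, map_pow, map_add, map_intCast, map_ofNat, aeval_X,
    map_one, eq_intCast]

theorem shanksPoly_irreducible (n : ℤ) : Irreducible (shanksPoly n) := by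
  have hd := shanksPoly_natDegree n
  rw [(shanksPoly_monic n).irreducible_iff_roots_eq_zero_of_degree_le_three (by omega) (by omega)]
  refine Multiset.eq_zero_of_forall_notMem fun r hr => ?_
  have h := (mem_roots'.1 hr).2
  have h' : r ^ 3 - n * r ^ 2 - (n + 3) * r - 1 = 0 := by
    have := aeval_shanksPoly n r
    rw [coe_aeval_eq_eval, h] at this
    simpa using this.symm
  have hu : r * (r ^ 2 - n * r - (n + 3)) = 1 := by linear_combination h'
  -- The cubic takes the odd value `-2n - 3` at `1` and the value `1` at `-1`.
  rcases Int.eq_one_or_neg_one_of_mul_eq_one hu with rfl | rfl <;> omega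

theorem map_shanksConj {F F' : Type*} [Field F] [Field F'] (f : F →+* F') (x : F) :
    f (shanksConj x) = shanksConj (f x) := by
  simp [shanksConj]

section GaloisGroup

variable {L : Type*} [Field L] [Algebra ℚ L] {n : ℤ} {g : L} {pb : PowerBasis ℚ L}

theorem minpoly_shanks (hg : g ^ 3 - n * g ^ 2 - (n + 3) * g - 1 = 0) :
    minpoly ℚ g = (shanksPoly n).map (algebraMap ℤ ℚ) := by
  symm
  refine minpoly.eq_of_irreducible_of_monic ?_ ?_ ((shanksPoly_monic n).map _)
  · exact ((shanksPoly_monic n).irreducible_iff_irreducible_map_fraction_map).1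
      (shanksPoly_irreducible n)
  · rw [aeval_map_algebraMap, aeval_shanksPoly, hg]

theorem algEquiv_ext_gen (hpb : pb.gen = g) {τ τ' : L ≃ₐ[ℚ] L} (h : τ g = τ' g) : τ = τ' := by
  subst hpb
  have := pb.algHom_ext (f := (τ : L →ₐ[ℚ] L)) (g := (τ' : L →ₐ[ℚ] L)) h
  ext x
  exact DFunLike.congr_fun this x

theorem finrank_shanks (hpb : pb.gen = g) (hg : g ^ 3 - n * g ^ 2 - (n + 3) * g - 1 = 0) :
    Module.finrank ℚ L = 3 := by
  rw [pb.finrank, ← pb.natDegree_minpoly, hpb, minpoly_shanks hg,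
    (shanksPoly_monic n).natDegree_map, shanksPoly_natDegree]

theorem exists_galois_generator (hpb : pb.gen = g)
    (hg : g ^ 3 - n * g ^ 2 - (n + 3) * g - 1 = 0) : ∃ σ : L ≃ₐ[ℚ] L, σ g = shanksConj g := by
  have : FiniteDimensional ℚ L := pb.finite
  have hroot : aeval (shanksConj g) (minpoly ℚ pb.gen) = 0 := by
    rw [hpb, minpoly_shanks hg, aeval_map_algebraMap, aeval_shanksPoly]
    exact (shanksConj_eq hg).2.2
  refine ⟨AlgEquiv.ofBijective (pb.lift _ hroot) (Algebra.IsAlgebraic.algHom_bijective _), ?_⟩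
  have := pb.lift_gen _ hroot
  rwa [hpb] at this

/-- A coincidence would make all three roots equal, so `3g = n` and `3g² = -(n + 3)`, whence `n² +
3n + 9 = 0`, which has no integer solution. -/
theorem shanksConj_gen_ne (hg : g ^ 3 - n * g ^ 2 - (n + 3) * g - 1 = 0) :
    shanksConj g ≠ g := by
  intro h
  have : CharZero L := charZero_of_injective_algebraMap (algebraMap ℚ L).injective
  obtain ⟨e1, e2, -⟩ := shanks_elementary hg
  rw [h, h] at e1 e2
  have h0 : ((n ^ 2 + 3 * n + 9 : ℤ) : L) = 0 := by
    push_cast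
    linear_combination -(n + 3 * g) * e1 + 3 * e2
  have h1 : n ^ 2 + 3 * n + 9 = 0 := by exact_mod_cast h0
  nlinarith [sq_nonneg (2 * n + 3)]

theorem exists_galois_enumeration (hpb : pb.gen = g) (hg : g ^ 3 - n * g ^ 2 - (n + 3) * g - 1 = 0)
    {σ : L ≃ₐ[ℚ] L}
    (hσ : σ g = shanksConj g) :
    (∀ x, σ (σ (σ x)) = x) ∧
    ∃ e : Fin 3 ≃ (L ≃ₐ[ℚ] L), e 0 = 1 ∧ e 1 = σ ∧ e 2 = σ * σ := by
  obtain ⟨e1, e2, e3⟩ := shanks_elementary hg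
  have hσ2 : σ (σ g) = shanksConj (shanksConj g) := by
    rw [hσ]
    exact (map_shanksConj (σ : L →+* L) g).trans (congrArg shanksConj hσ)
  have hσ3 : σ (σ (σ g)) = g := by
    rw [hσ2]
    refine (map_shanksConj (σ : L →+* L) _).trans ?_
    rw [show (σ : L →+* L) (shanksConj g) = shanksConj (shanksConj g) by
      rw [← hσ2, hσ]; rfl]
    exact e3
  have h3 : σ * σ * σ = 1 := algEquiv_ext_gen hpb hσ3
  have h1 : σ ≠ 1 := by
    intro h
    rw [h] at hσ
    exact shanksConj_gen_ne hg hσ.symm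
  refine ⟨fun x => DFunLike.congr_fun h3 x, Equiv.ofBijective ![1, σ, σ * σ] ⟨?_, ?_⟩, rfl, rfl, rfl⟩
  · have h2 : σ * σ ≠ 1 := fun h => h1 (by rw [h, one_mul] at h3; exact h3)
    have h4 : σ ≠ σ * σ := fun h => h1 (left_eq_mul.1 h)
    intro i j hij
    fin_cases i <;> fin_cases j
    · rfl
    · exact absurd hij.symm h1
    · exact absurd hij.symm h2
    · exact absurd hij h1
    · rfl
    · exact absurd hij h4
    · exact absurd hij h2
    · exact absurd hij.symm h4
    · rfl
  · intro τ
    have hτ : (τ g) ^ 3 - n * (τ g) ^ 2 - (n + 3) * τ g - 1 = 0 := by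
      have := congrArg τ hg
      simpa only [map_sub, map_mul, map_add, map_pow, map_intCast, map_ofNat, map_one,
        map_zero] using this
    have hg3 : g * shanksConj g * shanksConj (shanksConj g) = 1 := by
      have m2 := shanksConj_mul (shanksConj_eq hg).2.2
      have m3 := shanksConj_mul (shanksConj_eq (shanksConj_eq hg).2.2).2.2
      rw [e3] at m3
      linear_combination g * m2 - m3
    have hfac : (τ g - g) * ((τ g - shanksConj g) * (τ g - shanksConj (shanksConj g))) = 0 := by
      linear_combination hτ - (τ g) ^ 2 * e1 + τ g * e2 - hg3
    rcases mul_eq_zero.1 hfac with h | h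
    · exact ⟨0, (algEquiv_ext_gen hpb (sub_eq_zero.1 h)).symm⟩
    rcases mul_eq_zero.1 h with h | h
    · exact ⟨1, (algEquiv_ext_gen hpb ((sub_eq_zero.1 h).trans hσ.symm)).symm⟩
    · exact ⟨2, (algEquiv_ext_gen hpb ((sub_eq_zero.1 h).trans hσ2.symm)).symm⟩

theorem mem_range_of_fixed (hpb : pb.gen = g) (hg : g ^ 3 - n * g ^ 2 - (n + 3) * g - 1 = 0) {σ : L ≃ₐ[ℚ] L}
    (e : Fin 3 ≃ (L ≃ₐ[ℚ] L)) (he0 : e 0 = 1) (he1 : e 1 = σ) (he2 : e 2 = σ * σ)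
    (x : L) (hx : σ x = x) : x ∈ Set.range (algebraMap ℚ L) := by
  have : FiniteDimensional ℚ L := pb.finite
  have : IsGalois ℚ L := by
    refine IsGalois.of_card_aut_eq_finrank _ _ ?_
    rw [finrank_shanks hpb hg, ← Nat.card_congr e, Nat.card_fin]
  rw [IsGalois.mem_range_algebraMap_iff_fixed]
  intro τ
  obtain ⟨i, rfl⟩ := e.surjective τ
  fin_cases i
  · simp [he0]
  · simpa [he1] using hx
  · simp [he2, hx]

end GaloisGroup

/-! ### The main theorem -/

theorem theorem2 (n : ℤ) (hn : ¬ (3 : ℤ) ∣ n ∨ n ≡ 12 [ZMOD 27])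
    (ρ : ℂ) (hρ : aeval ρ (shanksPoly n) = 0)
    (d e c : ℤ) (hd : 0 < d) (he : 0 < e) (hc : 0 < c)
    (hdsq : Squarefree d) (hesq : Squarefree e) (hde : IsCoprime d e)
    (hΔ : n ^ 2 + 3 * n + 9 = d * e ^ 2 * c ^ 3)
    (a₀ a₁ : ℤ) (hnorm : e * c = a₀ ^ 2 - a₀ * a₁ + a₁ ^ 2)
    (hdvd : eisenstein a₀ a₁ ∣ eisenstein (n + 3) 3) :
    (∃ ε : ℤ, IsShanksSign n a₀ a₁ ε) ∧
      ∀ ε : ℤ, IsShanksSign n a₀ a₁ ε →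
        ∃ m : ℤ, 3 * m = ε * e * c ^ 2 - n * (a₀ + a₁) ∧
          {B : Set ℚ⟮ρ⟯ | IsNormalIntegralBasis ℚ⟮ρ⟯ B} =
            {shanksTriple (AdjoinSimple.gen ℚ ρ) a₀ a₁ m (e * c ^ 2),
             negShanksTriple (AdjoinSimple.gen ℚ ρ) a₀ a₁ m (e * c ^ 2)} ∧
          shanksTriple (AdjoinSimple.gen ℚ ρ) a₀ a₁ m (e * c ^ 2) ≠
            negShanksTriple (AdjoinSimple.gen ℚ ρ) a₀ a₁ m (e * c ^ 2) := by
  obtain ⟨hde3, hsign, k₀, k₁, hK, hKnorm, hcong⟩ := shanks_arithmetic hn he hc hdsq hesq hde hΔ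
    hnorm (eis_dvd_of_eisenstein_dvd hdvd)
  refine ⟨hsign, fun ε hε => ?_⟩
  obtain ⟨h1, h0, m, hm⟩ := hcong ε hε
  refine ⟨m, hm.symm, ?_⟩
  have hq0 : e * c ^ 2 ≠ 0 := (by positivity)
  have hρ' := hρ
  rw [aeval_shanksPoly] at hρ'
  have hg : (AdjoinSimple.gen ℚ ρ) ^ 3 - n * (AdjoinSimple.gen ℚ ρ) ^ 2
      - (n + 3) * AdjoinSimple.gen ℚ ρ - 1 = 0 := by
    apply (algebraMap ℚ⟮ρ⟯ ℂ).injective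
    simpa only [map_sub, map_mul, map_add, map_pow, map_intCast, map_ofNat, map_one, map_zero,
      AdjoinSimple.algebraMap_gen] using hρ'
  obtain ⟨pb, hpb⟩ : ∃ pb : PowerBasis ℚ ℚ⟮ρ⟯, pb.gen = AdjoinSimple.gen ℚ ρ := by
    have hint : IsIntegral ℚ ρ := ⟨(shanksPoly n).map (algebraMap ℤ ℚ),
      (shanksPoly_monic n).map _, by rw [← aeval_def, aeval_map_algebraMap, hρ]⟩
    exact ⟨adjoin.powerBasis hint, adjoin.powerBasis_gen hint⟩
  obtain ⟨σ, hσ⟩ := exists_galois_generator hpb hg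
  obtain ⟨hσ3, E, hE0, hE1, hE2⟩ := exists_galois_enumeration hpb hg hσ
  have hfix := mem_range_of_fixed hpb hg E hE0 hE1 hE2
  have hσc : ∀ x, σ (shanksConj x) = shanksConj (σ x) :=
    map_shanksConj (σ : ℚ⟮ρ⟯ →+* ℚ⟮ρ⟯)
  have hge3 := (shanks_elementary hg).2.2
  set g := AdjoinSimple.gen ℚ ρ with hgdef
  set α := shanksGen g (shanksConj g) a₀ a₁ m (e * c ^ 2) with hα
  have hgen : ∀ (τ : ℚ⟮ρ⟯ ≃ₐ[ℚ] ℚ⟮ρ⟯) (x y : ℚ⟮ρ⟯), τ (shanksGen x y a₀ a₁ m (e * c ^ 2)) =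
      shanksGen (τ x) (τ y) a₀ a₁ m (e * c ^ 2) := fun τ x y => by
    simp only [shanksGen, map_div₀, map_add, map_mul, map_intCast]
  have hα1 : σ α = shanksGen (shanksConj g) (shanksConj (shanksConj g)) a₀ a₁ m (e * c ^ 2) := by
    rw [hα, hgen, hσc, hσ]
  have hα2 : σ (σ α) = shanksGen (shanksConj (shanksConj g)) g a₀ a₁ m (e * c ^ 2) := by
    rw [hα1, hgen, hσc (shanksConj g), hσc g, hσ, hge3]
  let ι : ℚ⟮ρ⟯ →+* ℂ := algebraMap ℚ⟮ρ⟯ ℂ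
  have hιg : ι g = ρ := AdjoinSimple.algebraMap_gen ℚ ρ
  have hι : ∀ x y : ℚ⟮ρ⟯, ι (shanksGen x y a₀ a₁ m (e * c ^ 2)) =
      shanksGen (ι x) (ι y) a₀ a₁ m (e * c ^ 2) := fun x y => by
    simp only [shanksGen, map_div₀, map_add, map_mul, map_intCast]
  have hια : ι α = shanksGen ρ (shanksConj ρ) a₀ a₁ m (e * c ^ 2) := by
    rw [hα, hι, map_shanksConj, hιg]
  have hια1 : ι (σ α) = shanksGen (shanksConj ρ) (shanksConj (shanksConj ρ)) a₀ a₁ m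
      (e * c ^ 2) := by
    rw [hα1, hι, map_shanksConj ι (shanksConj g), map_shanksConj ι g, hιg]
  have hια2 : ι (σ (σ α)) = shanksGen (shanksConj (shanksConj ρ)) ρ a₀ a₁ m (e * c ^ 2) := by
    rw [hα2, hι, map_shanksConj ι (shanksConj g), map_shanksConj ι g, hιg]
  have hz := zetaThree_sq
  have hz' : (zetaThree ^ 2) ^ 2 = -1 - zetaThree ^ 2 := by
    linear_combination (zetaThree ^ 2 - zetaThree + 1) * hz
  have hz4 : (zetaThree ^ 2) ^ 2 = zetaThree := by
    linear_combination (zetaThree ^ 2 - zetaThree) * hz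
  have hcube := shanksGen_resolvent_cube (m := m) hz hρ' he.ne' hc.ne' hΔ hnorm hK
  have hcube' := shanksGen_resolvent_cube (m := m) hz' hρ' he.ne' hc.ne' hΔ hnorm hK
  have hprod := shanksGen_resolvent_norm (m := m) hz hρ' he.ne' hc.ne' hΔ hnorm
  rw [hz4] at hcube'
  rw [← hια, ← hια1, ← hια2] at hcube hcube' hprod
  have hsum : α + σ α + σ (σ α) = ε := by
    rw [hα2, hα1]
    exact shanksGen_sum hg (Int.cast_ne_zero.2 hq0) (by rw [← hm]; ring)
  have hsumι : ι α + ι (σ α) + ι (σ (σ α)) = ε := by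
    rw [← map_add, ← map_add, hsum, map_intCast]
  have hαint : IsIntegral ℤ α := by
    -- The resolvents involve `ζ`, so integrality is tested after embedding in `ℂ`.
    rw [← isIntegral_algebraMap_iff (algebraMap ℚ⟮ρ⟯ ℂ).injective]
    exact isIntegral_of_resolvents hz hε.1 hsumι hprod hcube hcube' hKnorm h1 h0
  have hprodL : (α + σ α + σ (σ α)) ^ 2 - 3 * (α * σ α + σ α * σ (σ α) + σ (σ α) * α) =
      (d * e : ℤ) := by
    apply ι.injective
    rw [map_intCast, ← hprod, resolvent_mul_resolvent hz]
    simp only [map_sub, map_mul, map_add, map_pow, map_ofNat]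
  have hsq : Squarefree (d * e) := (squarefree_mul_iff).2 ⟨hde.isRelPrime, hdsq, hesq⟩
  have hspan : ∀ β : ℚ⟮ρ⟯, IsIntegral ℤ β → ∃ X Y Z : ℤ, β = X * α + Y * σ α + Z * σ (σ α) :=
    fun β hβ => exists_int_combination hσ3 hfix ι hsq hde3 hε.1 hαint hsum hprodL hcube hKnorm hβ
  have hind : ∀ X Y Z : ℤ, X * α + Y * σ α + Z * σ (σ α) = 0 → X = 0 ∧ Y = 0 ∧ Z = 0 :=
    fun X Y Z h => int_combination_eq_zero hσ3 hε.1 hsq.ne_zero hsum hprodL h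
  have hS : shanksTriple g a₀ a₁ m (e * c ^ 2) = {α, σ α, σ (σ α)} := by
    rw [hα2, hα1]; rfl
  have hS' : negShanksTriple g a₀ a₁ m (e * c ^ 2) = {-α, -σ α, -σ (σ α)} := by
    rw [hα2, hα1]; rfl
  rw [hS, hS']
  exact ⟨setOf_isNormalIntegralBasis E hE0 hE1 hE2 hσ3 hαint hspan hind, triple_ne_neg_triple hind⟩
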